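/- **Setting.** A *variable-event graph* is a finite bipartite graph whose nodes are of two kinds, random variables and bad events. Each random-variable node $u$ carries the probability space $\Omega_u=\{0,1\}^{\mathbb N}$ of infinite lists of independent fair bits, and each bad-event node $v$ with neighbors $u_1,\dots,u_d$ is labeled with a (measurable) event $\mathcal E_v$ on $\prod_{i}\Omega_{u_i}$. Its *dependency graph* has the bad-event nodes as vertices, two of them being adjacent if they share a random variable. For real $C$ and integer $\Delta$, it is an instance of the *$C$-relaxed Lovász local lemma* (with degree bound $\Delta$) if the dependency graph has maximum degree at most $\Delta$ and there is a $p$ with $p\cdot\Delta^{C}\le 1$ such that $P(\mathcal E_v)\le p$ for every bad-event node $v$. A *randomized sequential local algorithm* of local complexity $t$ processes the nodes of the graph one after another, in an order that is fixed before the random bits are sampled. When a node $u$ is processed, an infinite list of independent fair bits is sampled at $u$, and the algorithm produces an output at $u$ and additional information stored at $u$. Both are a function of the number $n$ of nodes of the graph, of the bits sampled at $u$, and of the isomorphism type of the labeled $t$-hop neighborhood of $u$, in which every previously processed node is also labeled with its output and its stored information. There are no identifiers. Here the output at a random-variable node $u$ fixes some (possibly none, possibly infinitely many) of the bits of $\Omega_u$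 to concrete values. **Theorem.** There are a constant $C_0$, a constant $t$ and a randomized sequential local algorithm $\mathcal A$ of local complexity $t$ such that for every $c\in\mathbb N$ there is a constant $K$ for which the following holds. Let $C\ge C_0$ and $\Delta\ge 2$, and run $\mathcal A$ on the $n$-node variable-event graph of any instance of the $C$-relaxed Lovász local lemma with degree bound $\Delta$, in any order of its nodes. Then, conditioned on the bits fixed by $\mathcal A$: 1. for every outcome of the random bits of $\mathcal A$, each bad event has conditional probability at most $1/(3\Delta)$; 2. with probability at least $1-n^{-c}$, every connected component of the residual dependency graph, that is, of the subgraph of the dependency graph induced by the bad events of nonzero conditional probability, has at most $K\Delta^{3}\log n$ vertices. -/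

import Mathlib

open MeasureTheory

/-! ### Random bits -/

/-- An infinite list of bits. -/
abbrev Bits : Type := ℕ → Bool

/-- The law of a single fair bit. -/
noncomputable def fairBit : Measure Bool := (PMF.uniformOfFintype Bool).toMeasure

instance : IsProbabilityMeasure fairBit := by
  unfold fairBit
  infer_instance

/-- The law of an infinite list of independent fair bits. -/
noncomputable def bitsMeasure : Measure Bits := Measure.infinitePi fun _ : ℕ => fairBit

instance : IsProbabilityMeasure bitsMeasure := by
  unfold bitsMeasure
  infer_instance

/-- The law of a family, indexed by `V`, of independent infinite lists of independent fair bits. -/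
noncomputable def bitsFamilyMeasure (V : Type) : Measure (V → Bits) :=
  Measure.infinitePi fun _ : V => bitsMeasure

instance (V : Type) : IsProbabilityMeasure (bitsFamilyMeasure V) := by
  unfold bitsFamilyMeasure
  infer_instance

/-! ### Instances of the Lovász local lemma as variable-event graphs -/

/-- A variable-event graph on the node set `V`: a bipartite graph whose nodes are either bad events
(`IsEvent v`) or random variables (`¬ IsEvent v`). The probability space of each random-variable
node is `Bits`, and each bad-event node is labeled with an event on the product of the probability
spaces of its neighbors. -/
structure VEGraph (V : Type) where
  graph : SimpleGraph V
  IsEvent : V → Prop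
  bipartite : ∀ u v, graph.Adj u v → (IsEvent u ↔ ¬ IsEvent v)
  event : (v : {v : V // IsEvent v}) → Set (graph.neighborSet v.1 → Bits)
  measurableSet_event : ∀ v, MeasurableSet (event v)

namespace VEGraph

variable {V : Type}

/-- The bad-event nodes. -/
abbrev EventNode (G : VEGraph V) : Type := {v : V // G.IsEvent v}

/-- The bad event at `v`, as an event on the joint sample space. (For convenience the joint sample
space has a coordinate for every node. Only the coordinates at the neighbors of `v`, which are
random-variable nodes, matter.) -/
def occurs (G : VEGraph V) (v : G.EventNode) : Set (V → Bits) :=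
  {ω | (fun u : G.graph.neighborSet v.1 => ω u.1) ∈ G.event v}

/-- The probability of the bad event at `v`. -/
noncomputable def prob (G : VEGraph V) (v : G.EventNode) : ℝ :=
  (bitsFamilyMeasure V).real (G.occurs v)

/-- The dependency graph: two different bad-event nodes are adjacent if they share a random
variable. -/
def dependencyGraph (G : VEGraph V) : SimpleGraph G.EventNode where
  Adj v w := v ≠ w ∧ ∃ u : V, G.graph.Adj u v.1 ∧ G.graph.Adj u w.1
  symm := ⟨fun _ _ h => ⟨h.1.symm, h.2.imp fun _ hu => ⟨hu.2, hu.1⟩⟩⟩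
  loopless := ⟨fun _ h => h.1 rfl⟩

/-- `G` is an instance of the `C`-relaxed Lovász local lemma whose dependency graph has maximum
degree at most `Δ`: every bad event has probability at most `p`, where `p * Δ ^ C ≤ 1`. -/
def IsRelaxedLLL (G : VEGraph V) (C : ℝ) (Δ : ℕ) : Prop :=
  (∀ v : G.EventNode, (G.dependencyGraph.neighborSet v).ncard ≤ Δ) ∧
    ∃ p : ℝ, p * (Δ : ℝ) ^ C ≤ 1 ∧ ∀ v : G.EventNode, G.prob v ≤ p

end VEGraph

/-! ### Fixing some of the bits -/

/-- A partial assignment of an infinite list of bits: `s i = some b` means that the `i`-th bit is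
fixed to `b`, and `s i = none` means that the `i`-th bit is not fixed. -/
abbrev PartialBits : Type := ℕ → Option Bool

/-- Replace the bits of `ω` at the fixed positions by their fixed values. -/
def overrideBits {V : Type} (s : V → PartialBits) (ω : V → Bits) : V → Bits :=
  fun u i => (s u i).getD (ω u i)

namespace VEGraph

variable {V : Type}

/-- The probability of the bad event at `v` conditioned on the bits fixed by `s`. All bits are
independent, so conditionally on the fixed bits (of which there may be infinitely many) the other
bits are still independent and fair. -/
noncomputable def condProb (G : VEGraph V) (s : V → PartialBits) (v : G.EventNode) : ℝ :=
  (bitsFamilyMeasure V).real {ω | overrideBits s ω ∈ G.occurs v}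

/-- The residual dependency graph after fixing bits: the subgraph of the dependency graph induced
by the bad events of nonzero conditional probability. -/
def residualGraph (G : VEGraph V) (s : V → PartialBits) :
    SimpleGraph {v : G.EventNode // G.condProb s v ≠ 0} :=
  G.dependencyGraph.induce {v : G.EventNode | G.condProb s v ≠ 0}

end VEGraph

/-! ### Randomized sequential local algorithms on variable-event graphs -/

/-- The nodes at distance at most `t` from `u`. -/
abbrev VEGraph.Ball {V : Type} (G : VEGraph V) (u : V) (t : ℕ) : Type :=
  {w : V // G.graph.edist u w ≤ (t : ℕ∞)}

/-- The labeled `t`-hop neighborhood of `u` in `G`, where the nodes carry the additional labels `σ`,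
is isomorphic to the labeled `t`-hop neighborhood of `u'` in `G'` with the additional labels `σ'`.
The isomorphism preserves the root, the edges, the kind of every node, the additional labels, and
the event labels of the bad-event nodes at distance less than `t` from the root. (These are the
nodes whose neighbors all lie in the neighborhood. The event of a node at distance exactly `t`
may involve nodes outside, and it is not visible.) -/
def SameNeighborhood {V V' L : Type} (t : ℕ) (G : VEGraph V) (σ : V → L) (u : V)
    (G' : VEGraph V') (σ' : V' → L) (u' : V') : Prop :=
  ∃ φ : G.Ball u t ≃ G'.Ball u' t,
    (∀ a : G.Ball u t, a.1 = u → (φ a).1 = u') ∧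
    (∀ a b : G.Ball u t, G.graph.Adj a.1 b.1 ↔ G'.graph.Adj (φ a).1 (φ b).1) ∧
    (∀ a : G.Ball u t, G.IsEvent a.1 ↔ G'.IsEvent (φ a).1) ∧
    (∀ a : G.Ball u t, σ a.1 = σ' (φ a).1) ∧
    (∀ (a : G.Ball u t) (ha : G.IsEvent a.1) (ha' : G'.IsEvent (φ a).1),
      G.graph.edist u a.1 < (t : ℕ∞) →
      ∀ (ω : V → Bits) (ω' : V' → Bits), (∀ b : G.Ball u t, ω b.1 = ω' (φ b).1) →
        (ω ∈ G.occurs ⟨a.1, ha⟩ ↔ ω' ∈ G'.occurs ⟨(φ a).1, ha'⟩))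

/-- A randomized sequential local algorithm of local complexity `t` on variable-event graphs, with
outputs in `Out`. When a node `u` is processed, the algorithm is given the number `n` of nodes,
the labeled `t n`-hop neighborhood of `u`, where every node processed before is labeled with the
pair of its output and its stored information (and every other node with `none`), and the random
bits sampled at `u`. It produces the output at `u` and the information stored at `u`. There are no
identifiers: by `local_step`, `step` is a function of the isomorphism type of the labeled
neighborhood. -/
structure RandSeqLocalAlgorithm (t : ℕ → ℕ) (Out : Type) where
  Mem : Type
  step : (n : ℕ) → {V : Type} → [Finite V] → VEGraph V → (V → Option (Out × Mem)) → (u : V) →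
    Bits → Out × Mem
  local_step : ∀ (n : ℕ) {V V' : Type} [Finite V] [Finite V'] (G : VEGraph V) (G' : VEGraph V')
    (σ : V → Option (Out × Mem)) (σ' : V' → Option (Out × Mem)) (u : V) (u' : V') (r : Bits),
    SameNeighborhood (t n) G σ u G' σ' u' → step n G σ u r = step n G' σ' u' r

namespace RandSeqLocalAlgorithm

variable {t : ℕ → ℕ} {Out : Type} {V : Type} [Finite V]

open Classical in
/-- The labels produced by running the algorithm on the nodes of `order`, one after another, where
`ρ u` are the random bits sampled at `u`. -/
noncomputable def run (A : RandSeqLocalAlgorithm t Out) (G : VEGraph V) (ρ : V → Bits)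
    (order : List V) : V → Option (Out × A.Mem) :=
  order.foldl
    (fun σ u => Function.update σ u (some (A.step (Nat.card V) G σ u (ρ u)))) (fun _ => none)

/-- The bits fixed by a run of an algorithm whose output at a node is a partial assignment of the
bits of that node. -/
noncomputable def fixedBits (A : RandSeqLocalAlgorithm t PartialBits) (G : VEGraph V)
    (ρ : V → Bits) (order : List V) : V → PartialBits :=
  fun u => ((A.run G ρ order u).map Prod.fst).getD (fun _ => none)

end RandSeqLocalAlgorithm

/-! ### Resampling some of the coordinates of a product measure -/

section Resample

variable {ι : Type*} {X : ι → Type*} [∀ i, MeasurableSpace (X i)]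

/-! Call an event dangerous when its conditional probability exceeds the square root of its original
probability. The algorithm reveals the bits at a node one by one and stops as soon as an adjacent
event is dangerous. One bit at most doubles a conditional probability (`lintegral_splice_succ_le`),
so none ever exceeds twice its threshold, which is claim 1. Danger is permanent, because every later
variable of a dangerous event stops before its first bit.

Conditional probabilities form a martingale along the run, so optional stopping
(`lintegral_condMeasure_fixNodes`) preserves the mean of the conditional probability of any
measurable set. For pairwise nonadjacent events this set is their intersection, whose conditional
probability is a product. Markov's inequality then bounds the chance that all of them become
dangerous by the product of their thresholds (`measure_dangerous_le`).

By Lévy's upward theorem, a node that is never stopped almost surely ends with all its bits fixed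
and no adjacent event dangerous. Hence an event that is still possible is dangerous or next to a
dangerous one: if all its variables are fully fixed, its conditional probability is 1. A residual
component with more than `i * (Δ + 1) ^ 2` vertices therefore yields `i + 1` pairwise nonadjacent
dangerous events on a closed walk with `2 * i` steps of length at most 4
(`exists_walk_of_lt_ncard_supp`). There are at most `n * (Δ + 1) ^ (8 * i)` such walks, each with
probability at most `Δ ^ (-17 * (i + 1))`, and a union bound with `i` of order `c * log n` gives
claim 2. -/

theorem measurable_piecewise_prod (S : Set ι) [∀ i, Decidable (i ∈ S)] :
    Measurable fun p : (∀ i, X i) × (∀ i, X i) => S.piecewise p.1 p.2 := by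
  refine measurable_pi_lambda _ fun i => ?_
  by_cases hi : i ∈ S
  · simp only [Set.piecewise_eq_of_mem _ _ _ hi]; fun_prop
  · simp only [Set.piecewise_eq_of_notMem _ _ _ hi]; fun_prop

/-- Taking the coordinates in `S` from one sample and the others from an independent sample
preserves the product measure. -/
theorem infinitePi_map_piecewise (P : ∀ i, Measure (X i)) [∀ i, IsProbabilityMeasure (P i)]
    (S : Set ι) [∀ i, Decidable (i ∈ S)] :
    ((Measure.infinitePi P).prod (Measure.infinitePi P)).map
      (fun p => S.piecewise p.1 p.2) = Measure.infinitePi P := by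
  refine Measure.eq_infinitePi P fun s t ht => ?_
  rw [Measure.map_apply (measurable_piecewise_prod S)
    (MeasurableSet.pi s.countable_toSet fun i _ => ht i)]
  have hpre : (fun p : (∀ i, X i) × (∀ i, X i) => S.piecewise p.1 p.2) ⁻¹' (Set.pi s t) =
      (Set.pi (s.filter (· ∈ S) : Finset ι) t) ×ˢ (Set.pi (s.filter (· ∉ S) : Finset ι) t) := by
    ext p
    simp only [Set.mem_preimage, Set.mem_pi, Set.mem_prod, Finset.coe_filter, Set.mem_ofPred_eq,
      Finset.mem_coe]
    constructor
    · refine fun h => ⟨fun i hi => ?_, fun i hi => ?_⟩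
      · simpa [hi.2] using h i hi.1
      · simpa [hi.2] using h i hi.1
    · rintro ⟨h₁, h₂⟩ i hi
      by_cases hS : i ∈ S
      · simpa [hS] using h₁ i ⟨hi, hS⟩
      · simpa [hS] using h₂ i ⟨hi, hS⟩
  rw [hpre, Measure.prod_prod, Measure.infinitePi_pi _ fun i _ => ht i,
    Measure.infinitePi_pi _ fun i _ => ht i, Finset.prod_filter_mul_prod_filter_not]

theorem lintegral_infinitePi_piecewise (P : ∀ i, Measure (X i)) [∀ i, IsProbabilityMeasure (P i)]
    (S : Set ι) [∀ i, Decidable (i ∈ S)] {g : (∀ i, X i) → ENNReal} (hg : Measurable g) :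
    ∫⁻ x, ∫⁻ y, g (S.piecewise x y) ∂Measure.infinitePi P ∂Measure.infinitePi P =
      ∫⁻ x, g x ∂Measure.infinitePi P := by
  conv_rhs => rw [← infinitePi_map_piecewise P S, lintegral_map hg (measurable_piecewise_prod S)]
  exact (lintegral_prod _ (hg.comp (measurable_piecewise_prod S)).aemeasurable).symm

/-- Fubini for a single coordinate, the form in which bits of a list and nodes of the graph are
averaged out one at a time. -/
theorem lintegral_infinitePi_update [DecidableEq ι] (P : ∀ i, Measure (X i)) [∀ i, IsProbabilityMeasure (P i)]
    (i : ι) {g : (∀ i, X i) → ENNReal} (hg : Measurable g) :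
    ∫⁻ x, ∫⁻ y, g (Function.update y i x) ∂Measure.infinitePi P ∂P i =
      ∫⁻ x, g x ∂Measure.infinitePi P := by
  classical
  rw [← lintegral_infinitePi_piecewise P {i} hg]
  have h : ∀ x y : ∀ i, X i, ({i} : Set ι).piecewise x y = Function.update y i (x i) := by
    intro x y
    ext j
    by_cases hj : j = i
    · subst hj; simp
    · simp [hj]
  simp only [h]
  have hm : Measurable fun x : X i =>
      ∫⁻ y, g (Function.update y i x) ∂Measure.infinitePi P := by
    refine Measurable.lintegral_prod_right' (f := fun q : X i × (∀ i, X i) =>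
      g (Function.update q.2 i q.1)) (hg.comp ?_)
    exact measurable_update'.comp measurable_swap
  rw [← (measurePreserving_eval_infinitePi P i).lintegral_comp hm]

/-- Events that depend on disjoint sets of coordinates are independent. -/
theorem infinitePi_inter_of_disjoint (P : ∀ i, Measure (X i)) [∀ i, IsProbabilityMeasure (P i)]
    (S : Set ι) {A B : Set (∀ i, X i)} (hA : MeasurableSet A) (hB : MeasurableSet B)
    (hAS : ∀ x y, (∀ i ∈ S, x i = y i) → (x ∈ A ↔ y ∈ A))
    (hBS : ∀ x y, (∀ i ∉ S, x i = y i) → (x ∈ B ↔ y ∈ B)) :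
    Measure.infinitePi P (A ∩ B) = Measure.infinitePi P A * Measure.infinitePi P B := by
  classical
  -- After writing the sample as `S.piecewise x y` with independent `x` and `y`, the set `A` sees
  -- only `x` and `B` only `y`, so the double integral factors.
  rw [← lintegral_indicator_one (hA.inter hB),
    ← lintegral_infinitePi_piecewise P S (measurable_one.indicator (hA.inter hB)),
    ← lintegral_indicator_one hA, ← lintegral_indicator_one hB,
    ← lintegral_mul_const _ (measurable_one.indicator hA)]
  refine lintegral_congr fun x => ?_
  rw [← lintegral_const_mul _ (measurable_one.indicator hB)]
  refine lintegral_congr fun y => ?_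
  have h₁ := hAS (S.piecewise x y) x fun i hi => by simp [hi]
  have h₂ := hBS (S.piecewise x y) y fun i hi => by simp [hi]
  rw [Set.inter_indicator_one, Pi.mul_apply]
  simp only [Set.indicator_apply, h₁, h₂, Pi.one_apply]

end Resample

/-! ### Infinite lists of fair bits, revealed one after another -/

theorem lintegral_fairBit (f : Bool → ENNReal) :
    ∫⁻ b, f b ∂fairBit = 2⁻¹ * f false + 2⁻¹ * f true := by
  rw [lintegral_fintype]
  simp [fairBit, mul_comm, add_comm]

/-- The first `k` bits are those of `r`, the others those of `r'`. -/
def splice (k : ℕ) (r r' : Bits) : Bits := fun i => if i < k then r i else r' i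

theorem splice_eq_piecewise (k : ℕ) (r r' : Bits) :
    splice k r r' = (Set.Iio k).piecewise r r' := by
  ext i
  by_cases h : i < k <;> simp [splice, Set.piecewise, h]

theorem measurable_splice (k : ℕ) : Measurable fun p : Bits × Bits => splice k p.1 p.2 := by
  simp_rw [splice_eq_piecewise]
  exact measurable_piecewise_prod (X := fun _ : ℕ => Bool) _

theorem measurable_splice_right (k : ℕ) (r : Bits) : Measurable (splice k r) :=
  (measurable_splice k).comp measurable_prodMk_left

@[simp] theorem splice_zero (r r' : Bits) : splice 0 r r' = r' := by
  ext i; simp [splice]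

theorem splice_splice_of_le {j k : ℕ} (h : j ≤ k) (r r' r'' : Bits) :
    splice j (splice k r r') r'' = splice j r r'' := by
  ext i
  by_cases hi : i < j
  · simp [splice, hi, hi.trans_le h]
  · simp [splice, hi]

theorem lintegral_splice (k : ℕ) {F : Bits → ENNReal} (hF : Measurable F) :
    ∫⁻ r, ∫⁻ r', F (splice k r r') ∂bitsMeasure ∂bitsMeasure = ∫⁻ r, F r ∂bitsMeasure := by
  simp_rw [splice_eq_piecewise]
  exact lintegral_infinitePi_piecewise (fun _ => fairBit) _ hF

/-- Revealing one more bit at most doubles the average of a nonnegative function. -/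
theorem lintegral_splice_succ_le (k : ℕ) (r : Bits) {F : Bits → ENNReal} (hF : Measurable F) :
    ∫⁻ r', F (splice (k + 1) r r') ∂bitsMeasure ≤
      2 * ∫⁻ r', F (splice k r r') ∂bitsMeasure := by
  classical
  have hm : ∀ k, Measurable fun r' => F (splice k r r') := fun k =>
    hF.comp (measurable_splice_right k r)
  have hs : ∀ r' : Bits, splice k r (Function.update r' k (r k)) = splice (k + 1) r r' := by
    intro r'
    ext i
    rcases lt_trichotomy i k with h | h | h
    · simp [splice, h, h.trans (Nat.lt_succ_self k)]
    · subst h; simp [splice]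
    · simp [splice, h.not_gt, h.ne', show ¬ i < k + 1 by omega]
  -- The average over bit `k` gives weight one half to the actual value `r k`; the other half is
  -- nonnegative and is dropped.
  have key : 2⁻¹ * ∫⁻ r', F (splice (k + 1) r r') ∂bitsMeasure ≤
      ∫⁻ r', F (splice k r r') ∂bitsMeasure := by
    rw [bitsMeasure, ← lintegral_infinitePi_update _ k (hm k), lintegral_fairBit]
    simp_rw [← hs]
    cases r k
    · exact le_add_right le_rfl
    · exact le_add_left le_rfl
  calc _ = 2 * (2⁻¹ * ∫⁻ r', F (splice (k + 1) r r') ∂bitsMeasure) := by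
        rw [← mul_assoc, ENNReal.mul_inv_cancel (by simp) (by simp), one_mul]
    _ ≤ _ := by gcongr

/-- The `σ`-algebras generated by the first bits. -/
def bitFiltration : Filtration ℕ (inferInstance : MeasurableSpace Bits) where
  -- Pulling back along the map that erases all bits from `k` on makes measurability a matter of
  -- factoring through that map.
  seq k := MeasurableSpace.comap (fun r => splice k r fun _ => false) inferInstance
  mono' := by
    intro j k hjk
    have h : (fun r : Bits => splice j r fun _ => false) =
        (fun r => splice j r fun _ => false) ∘ fun r => splice k r fun _ => false := by
      funext r
      exact (splice_splice_of_le hjk _ _ _).symm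
    show MeasurableSpace.comap _ _ ≤ MeasurableSpace.comap _ _
    rw [h, ← MeasurableSpace.comap_comp]
    exact MeasurableSpace.comap_mono
      ((measurable_splice j).comp measurable_prodMk_right).comap_le
  le' k := ((measurable_splice k).comp measurable_prodMk_right).comap_le

theorem iSup_bitFiltration :
    ⨆ k, bitFiltration k = (inferInstance : MeasurableSpace Bits) := by
  refine le_antisymm (iSup_le fun k => bitFiltration.le k) ?_
  refine iSup_le fun i => ?_
  refine le_trans ?_ (le_iSup _ (i + 1))
  have h : (fun r : Bits => r i) = (fun r => r i) ∘ fun r => splice (i + 1) r fun _ => false := by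
    funext r; simp [splice]
  rw [show (fun r : Bits => r i) = _ from h, ← MeasurableSpace.comap_comp]
  exact MeasurableSpace.comap_mono (measurable_pi_apply i).comap_le

/-- Lévy's upward theorem for infinite lists of bits: the averages over the bits that are not yet
revealed converge almost surely. -/
theorem tendsto_lintegral_splice {F : Bits → ENNReal} (hF : Measurable F) (hF1 : ∀ r, F r ≤ 1) :
    ∀ᵐ r ∂bitsMeasure, Filter.Tendsto (fun k => ∫⁻ r', F (splice k r r') ∂bitsMeasure)
      Filter.atTop (nhds (F r)) := by
  have hFt : ∀ r, F r ≠ ⊤ := fun r => ((hF1 r).trans_lt ENNReal.one_lt_top).ne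
  have hE1 : ∀ k r, ∫⁻ r', F (splice k r r') ∂bitsMeasure ≤ 1 := fun k r =>
    (lintegral_mono fun r' => hF1 _).trans (by simp)
  have hEt : ∀ k r, ∫⁻ r', F (splice k r r') ∂bitsMeasure ≠ ⊤ := fun k r =>
    ((hE1 k r).trans_lt ENNReal.one_lt_top).ne
  have hEm : ∀ k, Measurable fun r => ∫⁻ r', F (splice k r r') ∂bitsMeasure := fun k =>
    Measurable.lintegral_prod_right' (f := fun p : Bits × Bits => F (splice k p.1 p.2))
      (hF.comp (measurable_splice k))
  have hint : ∀ G : Bits → ENNReal, Measurable G → (∀ r, G r ≤ 1) →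
      Integrable (fun r => (G r).toReal) bitsMeasure := by
    intro G hG hG1
    refine integrable_toReal_of_lintegral_ne_top hG.aemeasurable ?_
    exact ((lintegral_mono hG1).trans_lt (by simp)).ne
  -- Averaging over the hidden bits is a version of the conditional expectation: re-splicing does
  -- not change membership in a set of the `k`-th `σ`-algebra.
  have hcond : ∀ k, (fun r => (∫⁻ r', F (splice k r r') ∂bitsMeasure).toReal) =ᵐ[bitsMeasure]
      bitsMeasure[fun r => (F r).toReal | bitFiltration k] := by
    intro k
    refine ae_eq_condExp_of_forall_setIntegral_eq (bitFiltration.le k) (hint F hF hF1)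
      (fun s _ _ => (hint _ (hEm k) (hE1 k)).integrableOn) ?_ ?_
    · intro s hs _
      have hsm := bitFiltration.le k s hs
      obtain ⟨B, hB, rfl⟩ := hs
      rw [integral_toReal (hEm k).aemeasurable (.of_forall fun r => (hEt k r).lt_top),
        integral_toReal hF.aemeasurable (.of_forall fun r => (hFt r).lt_top)]
      congr 1
      rw [← lintegral_indicator hsm, ← lintegral_indicator hsm,
        ← lintegral_splice k (hF.indicator hsm)]
      refine lintegral_congr fun r => ?_
      by_cases hr : r ∈ (fun r => splice k r fun _ => false) ⁻¹' B
      · rw [Set.indicator_of_mem hr]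
        refine lintegral_congr fun r' => ?_
        rw [Set.indicator_of_mem]
        simpa [splice_splice_of_le le_rfl] using hr
      · rw [Set.indicator_of_notMem hr, eq_comm]
        refine (lintegral_congr fun r' => ?_).trans lintegral_zero
        rw [Set.indicator_of_notMem]
        simpa [splice_splice_of_le le_rfl] using hr
    · refine StronglyMeasurable.aestronglyMeasurable ?_
      refine Measurable.stronglyMeasurable ?_
      have : (fun r => (∫⁻ r', F (splice k r r') ∂bitsMeasure).toReal) =
          (fun r => (∫⁻ r', F (splice k r r') ∂bitsMeasure).toReal) ∘
            fun r => splice k r fun _ => false := by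
        funext r
        simp [splice_splice_of_le le_rfl]
      rw [this]
      exact (hEm k).ennreal_toReal.comp (comap_measurable _)
  have hlim := (hint F hF hF1).tendsto_ae_condExp (ℱ := bitFiltration) (by
    rw [iSup_bitFiltration]
    exact hF.ennreal_toReal.stronglyMeasurable)
  filter_upwards [hlim, ae_all_iff.2 hcond] with r hr hk
  rw [← ENNReal.tendsto_toReal_iff (fun k => hEt k r) (hFt r)]
  simpa [hk] using hr

/-! ### Revealing bits until a condition is met -/

/-- The partial assignment that fixes the first `k` bits to those of `r`. -/
def prefixBits (k : ℕ) (r : Bits) : PartialBits := fun i => if i < k then some (r i) else none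

/-- The partial assignment that fixes all bits to those of `r`. -/
def fullBits (r : Bits) : PartialBits := fun i => some (r i)

open Classical in
/-- Reveal the bits of `r` one after another, up to the first moment at which the partial assignment
satisfies `E`. If no finite partial assignment satisfies `E`, but the assignment of all bits does,
then no bit is revealed. -/
noncomputable def revealBits (E : PartialBits → Prop) (r : Bits) : PartialBits := fun i =>
  -- Prefixes of length `j ≤ i` do not contain bit `i`, so stopping at `k` fixes exactly the bits
  -- below `k`. The second condition handles outcomes where `E` appears only in the limit: revealing
  -- nothing there keeps the probability bounds valid for every outcome.
  if (∀ j ≤ i, ¬ E (prefixBits j r)) ∧ ((∃ k, E (prefixBits k r)) ∨ ¬ E (fullBits r))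
    then some (r i) else none

@[simp] theorem prefixBits_zero (r : Bits) : prefixBits 0 r = fun _ => none := by
  ext i; simp [prefixBits]

theorem prefixBits_splice {j k : ℕ} (h : j ≤ k) (r r' : Bits) :
    prefixBits j (splice k r r') = prefixBits j r := by
  funext i
  by_cases hi : i < j
  · simp [prefixBits, splice, hi, hi.trans_le h]
  · simp [prefixBits, hi]

section Reveal

variable {E : PartialBits → Prop} {r : Bits}

theorem revealBits_eq_prefixBits {k : ℕ} (hk : E (prefixBits k r))
    (hlt : ∀ j < k, ¬ E (prefixBits j r)) : revealBits E r = prefixBits k r := by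
  funext i
  by_cases hi : i < k
  · rw [revealBits, if_pos ⟨fun j hj => hlt j (hj.trans_lt hi), Or.inl ⟨k, hk⟩⟩, prefixBits,
      if_pos hi]
  · rw [revealBits, if_neg fun h => h.1 k (not_lt.1 hi) hk, prefixBits, if_neg hi]

theorem revealBits_eq_fullBits (hlt : ∀ k, ¬ E (prefixBits k r)) (hf : ¬ E (fullBits r)) :
    revealBits E r = fullBits r := by
  funext i
  rw [revealBits, if_pos ⟨fun j _ => hlt j, Or.inr hf⟩, fullBits]

theorem revealBits_eq_none (hlt : ∀ k, ¬ E (prefixBits k r)) (hf : E (fullBits r)) :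
    revealBits E r = fun _ => none := by
  funext i
  rw [revealBits, if_neg]
  rintro ⟨-, ⟨k, hk⟩ | h⟩
  · exact hlt k hk
  · exact h hf

theorem revealBits_cases (E : PartialBits → Prop) (r : Bits) :
    (∃ k, E (prefixBits k r) ∧ (∀ j < k, ¬ E (prefixBits j r)) ∧
      revealBits E r = prefixBits k r) ∨
    ((∀ k, ¬ E (prefixBits k r)) ∧ ¬ E (fullBits r) ∧ revealBits E r = fullBits r) ∨
    ((∀ k, ¬ E (prefixBits k r)) ∧ E (fullBits r) ∧ revealBits E r = fun _ => none) := by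
  classical
  by_cases h : ∃ k, E (prefixBits k r)
  · have hlt : ∀ j < Nat.find h, ¬ E (prefixBits j r) := fun j hj => Nat.find_min h hj
    exact Or.inl ⟨Nat.find h, Nat.find_spec h, hlt, revealBits_eq_prefixBits (Nat.find_spec h) hlt⟩
  · push Not at h
    by_cases hf : E (fullBits r)
    · exact Or.inr (Or.inr ⟨h, hf, revealBits_eq_none h hf⟩)
    · exact Or.inr (Or.inl ⟨h, hf, revealBits_eq_fullBits h hf⟩)

/-- Optional stopping: revealing bits up to a stopping time does not change the expected
conditional average. -/
theorem lintegral_revealBits (hE : ∀ k, MeasurableSet {r | E (prefixBits k r)})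
    (hnull : ∀ᵐ r ∂bitsMeasure, (∀ k, ¬ E (prefixBits k r)) → ¬ E (fullBits r))
    {W : PartialBits → ENNReal} {F : Bits → ENNReal} (hF : Measurable F)
    (hfull : ∀ r, W (fullBits r) = F r)
    (hpre : ∀ k r, W (prefixBits k r) = ∫⁻ r', F (splice k r r') ∂bitsMeasure) :
    ∫⁻ r, W (revealBits E r) ∂bitsMeasure = ∫⁻ r, F r ∂bitsMeasure := by
  -- `A k` is the event of stopping after exactly `k` bits. It is decided by the first `k` bits, so
  -- the remaining ones can be averaged afresh on it.
  set A : ℕ → Set Bits := fun k => {r | E (prefixBits k r) ∧ ∀ j < k, ¬ E (prefixBits j r)}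
    with hA
  have hAm : ∀ k, MeasurableSet (A k) := by
    intro k
    have : A k = {r | E (prefixBits k r)} ∩ ⋂ j, ⋂ (_ : j < k), {r | E (prefixBits j r)}ᶜ := by
      ext r
      simp [hA]
    rw [this]
    exact (hE k).inter (.iInter fun j => .iInter fun _ => (hE j).compl)
  have hAd : Pairwise (Function.onFun Disjoint A) := by
    intro i j hij
    refine Set.disjoint_left.2 fun r hi hj => ?_
    rcases lt_or_gt_of_ne hij with h | h
    · exact hj.2 i h hi.1
    · exact hi.2 j h hj.1
  have hAs : ∀ k r r', splice k r r' ∈ A k ↔ r ∈ A k := by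
    intro k r r'
    simp only [hA, Set.mem_ofPred_eq, prefixBits_splice le_rfl]
    refine and_congr_right fun _ => forall₂_congr fun j hj => ?_
    rw [prefixBits_splice hj.le]
  have hUm : MeasurableSet (⋃ k, A k) := .iUnion hAm
  rw [← lintegral_add_compl _ hUm, ← lintegral_add_compl F hUm, lintegral_iUnion hAm hAd,
    lintegral_iUnion hAm hAd]
  congr 1
  · refine tsum_congr fun k => ?_
    rw [← lintegral_indicator (hAm k), ← lintegral_indicator (hAm k),
      ← lintegral_splice k (hF.indicator (hAm k))]
    refine lintegral_congr fun r => ?_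
    by_cases hr : r ∈ A k
    · rw [Set.indicator_of_mem hr, revealBits_eq_prefixBits hr.1 hr.2, hpre]
      refine lintegral_congr fun r' => ?_
      rw [Set.indicator_of_mem ((hAs k r r').2 hr)]
    · rw [Set.indicator_of_notMem hr, eq_comm]
      refine (lintegral_congr fun r' => ?_).trans lintegral_zero
      rw [Set.indicator_of_notMem fun h => hr ((hAs k r r').1 h)]
  · refine setLIntegral_congr_fun_ae hUm.compl ?_
    filter_upwards [hnull] with r hr hrU
    have hnone : ∀ k, ¬ E (prefixBits k r) := by
      intro k hk
      classical
      have hex : ∃ k, E (prefixBits k r) := ⟨k, hk⟩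
      exact hrU (Set.mem_iUnion.2
        ⟨Nat.find hex, Nat.find_spec hex, fun j hj => Nat.find_min hex hj⟩)
    rw [revealBits_eq_fullBits hnone (hr hnone), hfull]

end Reveal

/-! ### Measurability of partial assignments -/

instance : MeasurableSpace (Option Bool) := ⊤

instance : DiscreteMeasurableSpace (Option Bool) := ⟨fun _ => trivial⟩

theorem measurable_prefixBits (k : ℕ) : Measurable (prefixBits k) := by
  refine measurable_pi_lambda _ fun i => ?_
  by_cases hi : i < k
  · simp only [prefixBits, hi, if_true]
    exact (Measurable.of_discrete (f := fun b : Bool => some b)).comp (measurable_pi_apply i)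
  · simp only [prefixBits, hi, if_false]
    exact measurable_const

theorem measurable_fullBits : Measurable fullBits :=
  measurable_pi_lambda _ fun i =>
    (Measurable.of_discrete (f := fun b : Bool => some b)).comp (measurable_pi_apply i)

theorem measurable_overrideBits {V : Type} :
    Measurable fun p : (V → PartialBits) × (V → Bits) => overrideBits p.1 p.2 := by
  refine measurable_pi_lambda _ fun u => measurable_pi_lambda _ fun i => ?_
  exact (Measurable.of_discrete (f := fun q : Option Bool × Bool => q.1.getD q.2)).comp
    (Measurable.prodMk (by fun_prop) (by fun_prop))

theorem measurable_overrideBits_right {V : Type} (s : V → PartialBits) :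
    Measurable (overrideBits s) :=
  measurable_overrideBits.comp measurable_prodMk_left

/-- The revealed bits depend measurably on the bits and on a parameter of the condition. -/
theorem measurable_revealBits {S : Type*} [MeasurableSpace S] {E : S → PartialBits → Prop}
    (hE : MeasurableSet {p : S × PartialBits | E p.1 p.2}) :
    Measurable fun p : S × Bits => revealBits (E p.1) p.2 := by
  classical
  have hp : ∀ k, MeasurableSet {p : S × Bits | E p.1 (prefixBits k p.2)} := fun k =>
    (measurable_fst.prodMk ((measurable_prefixBits k).comp measurable_snd)) hE
  have hf : MeasurableSet {p : S × Bits | E p.1 (fullBits p.2)} :=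
    (measurable_fst.prodMk (measurable_fullBits.comp measurable_snd)) hE
  have hex : MeasurableSet {p : S × Bits | ∃ k, E p.1 (prefixBits k p.2)} := by
    simpa only [Set.iUnion_ofPred] using MeasurableSet.iUnion hp
  refine measurable_pi_lambda _ fun i => ?_
  have hall : MeasurableSet {p : S × Bits | ∀ j ≤ i, ¬ E p.1 (prefixBits j p.2)} := by
    have : {p : S × Bits | ∀ j ≤ i, ¬ E p.1 (prefixBits j p.2)} =
        ⋂ j, ⋂ (_ : j ≤ i), {p : S × Bits | E p.1 (prefixBits j p.2)}ᶜ := by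
      ext p; simp
    rw [this]
    exact .iInter fun j => .iInter fun _ => (hp j).compl
  refine Measurable.ite (hall.inter (hex.union hf.compl)) ?_ measurable_const
  exact (Measurable.of_discrete (f := fun b : Bool => some b)).comp (by fun_prop)

/-! ### Conditional probabilities -/

/-- Fubini in the form needed for induction along the processing order: the bits at `u` are split
off from the rest. -/
theorem ae_bitsFamilyMeasure_of_update {V : Type} [DecidableEq V] (u : V) {p : (V → Bits) → Prop}
    (hp : MeasurableSet {ρ | p ρ})
    (h : ∀ᵐ r ∂bitsMeasure, ∀ᵐ ρ ∂bitsFamilyMeasure V, p (Function.update ρ u r)) :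
    ∀ᵐ ρ ∂bitsFamilyMeasure V, p ρ := by
  have hm : Measurable ({ρ | p ρ}ᶜ.indicator (1 : (V → Bits) → ENNReal)) :=
    measurable_one.indicator hp.compl
  have hz : bitsFamilyMeasure V {ρ | p ρ}ᶜ = 0 := by
    rw [← lintegral_indicator_one hp.compl, bitsFamilyMeasure,
      ← lintegral_infinitePi_update _ u hm]
    refine lintegral_eq_zero_of_ae_eq_zero ?_
    filter_upwards [h] with r hr
    refine lintegral_eq_zero_of_ae_eq_zero ?_
    filter_upwards [hr] with ρ hρ
    exact Set.indicator_of_notMem (Set.notMem_compl_iff.2 hρ) _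
  exact hz

section CondMeasure

variable {V : Type}

/-- The probability of `A` conditioned on the bits fixed by `s`. -/
noncomputable def condMeasure (s : V → PartialBits) (A : Set (V → Bits)) : ENNReal :=
  bitsFamilyMeasure V {ω | overrideBits s ω ∈ A}

theorem condMeasure_le_one (s : V → PartialBits) (A : Set (V → Bits)) : condMeasure s A ≤ 1 :=
  prob_le_one

theorem condMeasure_none (A : Set (V → Bits)) :
    condMeasure (fun _ _ => none) A = bitsFamilyMeasure V A := rfl

theorem measurable_condMeasure {A : Set (V → Bits)} (hA : MeasurableSet A) :
    Measurable fun s : V → PartialBits => condMeasure s A :=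
  measurable_measure_prodMk_left (measurable_overrideBits hA)

/-- The hidden bits at `u` can be sampled separately, so conditioning on a prefix means averaging
over its completions. Doubling, Lévy's theorem and optional stopping all reach conditional
probabilities through this identity. -/
theorem condMeasure_update_prefixBits [DecidableEq V] (s : V → PartialBits) (u : V) (k : ℕ)
    (r : Bits) {A : Set (V → Bits)} (hA : MeasurableSet A) :
    condMeasure (Function.update s u (prefixBits k r)) A =
      ∫⁻ r', condMeasure (Function.update s u (fullBits (splice k r r'))) A ∂bitsMeasure := by
  classical
  have hm : ∀ s : V → PartialBits, MeasurableSet {ω | overrideBits s ω ∈ A} := fun s =>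
    measurable_overrideBits_right s hA
  rw [condMeasure, ← lintegral_indicator_one (hm _), bitsFamilyMeasure,
    ← lintegral_infinitePi_update _ u (measurable_one.indicator (hm _))]
  refine lintegral_congr fun r' => ?_
  rw [condMeasure, ← lintegral_indicator_one (hm _), bitsFamilyMeasure]
  refine lintegral_congr fun ω => ?_
  have h : overrideBits (Function.update s u (prefixBits k r)) (Function.update ω u r') =
      overrideBits (Function.update s u (fullBits (splice k r r'))) ω := by
    funext v i
    by_cases hv : v = u
    · subst hv
      by_cases hi : i < k <;> simp [overrideBits, prefixBits, fullBits, splice, hi]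
    · simp [overrideBits, hv]
  simp only [Set.indicator_apply, Set.mem_ofPred_eq, h, Pi.one_apply]

theorem measurable_condMeasure_update_fullBits [DecidableEq V] (s : V → PartialBits) (u : V)
    {A : Set (V → Bits)} (hA : MeasurableSet A) :
    Measurable fun r => condMeasure (Function.update s u (fullBits r)) A :=
  (measurable_condMeasure hA).comp ((measurable_update s).comp measurable_fullBits)

theorem update_none_of_eq_none [DecidableEq V] {s : V → PartialBits} {u : V}
    (hu : s u = fun _ => none) : Function.update s u (fun _ => none) = s := by
  rw [← hu, Function.update_eq_self]

end CondMeasure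

/-! ### Fixing the bits of a variable-event graph, node by node -/

namespace VEGraph

variable {V : Type} (G : VEGraph V)

theorem measurableSet_occurs (w : G.EventNode) : MeasurableSet (G.occurs w) :=
  (measurable_pi_lambda _ fun u => measurable_pi_apply u.1) (G.measurableSet_event w)

theorem mem_occurs_congr {w : G.EventNode} {ω ω' : V → Bits}
    (h : ∀ u, G.graph.Adj u w.1 → ω u = ω' u) : ω ∈ G.occurs w ↔ ω' ∈ G.occurs w := by
  have : (fun u : G.graph.neighborSet w.1 => ω u.1) = fun u => ω' u.1 :=
    funext fun u => h u.1 u.2.symm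
  simp only [occurs, Set.mem_ofPred_eq, this]

/-- The square root of the probability of an event. -/
noncomputable def threshold (w : G.EventNode) : ENNReal :=
  bitsFamilyMeasure V (G.occurs w) ^ (1 / 2 : ℝ)

/-- The conditional probability of the event `w` exceeds its threshold. -/
def Dangerous (s : V → PartialBits) (w : G.EventNode) : Prop :=
  G.threshold w < condMeasure s (G.occurs w)

open Classical in
/-- Fixing the bits `x` at `u` makes an event that involves `u` dangerous. -/
def Stops (s : V → PartialBits) (u : V) (x : PartialBits) : Prop :=
  ∃ w : G.EventNode, G.graph.Adj u w.1 ∧ G.Dangerous (Function.update s u x) w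

open Classical in
/-- Fix bits at `u` until an event that involves `u` becomes dangerous. -/
noncomputable def fixNode (s : V → PartialBits) (u : V) (r : Bits) : V → PartialBits :=
  Function.update s u (revealBits (G.Stops s u) r)

/-- Fix bits at the nodes of a list, one after another. -/
noncomputable def fixNodes : List V → (V → PartialBits) → (V → Bits) → V → PartialBits
  | [], s, _ => s
  | u :: l, s, ρ => fixNodes l (G.fixNode s u (ρ u)) ρ

/-- If no finite number of revealed bits at `u` makes an event dangerous, then neither do all. -/
def Regular (s : V → PartialBits) (u : V) (r : Bits) : Prop :=
  (∀ k, ¬ G.Stops s u (prefixBits k r)) → ¬ G.Stops s u (fullBits r)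

/-- All steps of `fixNodes` are regular. -/
def RegularRun : List V → (V → PartialBits) → (V → Bits) → Prop
  | [], _, _ => True
  | u :: l, s, ρ => G.Regular s u (ρ u) ∧ RegularRun l (G.fixNode s u (ρ u)) ρ

theorem fixNode_of_ne {s : V → PartialBits} {u v : V} (r : Bits) (h : v ≠ u) :
    G.fixNode s u r v = s v := by
  simp [fixNode, h]

/-- The bits at a node are read only when it is processed, so those of a processed node can be
integrated out first. -/
theorem fixNodes_update [DecidableEq V] {l : List V} {u : V} (hu : u ∉ l) (s : V → PartialBits)
    (ρ : V → Bits) (r : Bits) :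
    G.fixNodes l s (Function.update ρ u r) = G.fixNodes l s ρ := by
  induction l generalizing s with
  | nil => rfl
  | cons v l ih =>
    rw [List.mem_cons, not_or] at hu
    rw [fixNodes, fixNodes, Function.update_of_ne (Ne.symm hu.1), ih hu.2]

theorem regularRun_update [DecidableEq V] {l : List V} {u : V} (hu : u ∉ l) (s : V → PartialBits)
    (ρ : V → Bits) (r : Bits) :
    G.RegularRun l s (Function.update ρ u r) ↔ G.RegularRun l s ρ := by
  induction l generalizing s with
  | nil => rfl
  | cons v l ih =>
    rw [List.mem_cons, not_or] at hu
    rw [RegularRun, RegularRun, Function.update_of_ne (Ne.symm hu.1), ih hu.2]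

theorem fixNodes_of_notMem {l : List V} {u : V} (hu : u ∉ l) (s : V → PartialBits)
    (ρ : V → Bits) : G.fixNodes l s ρ u = s u := by
  induction l generalizing s with
  | nil => rfl
  | cons v l ih =>
    rw [List.mem_cons, not_or] at hu
    rw [fixNodes, ih hu.2, G.fixNode_of_ne _ hu.1]

/-! #### Measurability -/

theorem measurableSet_dangerous (w : G.EventNode) :
    MeasurableSet {s : V → PartialBits | G.Dangerous s w} :=
  measurableSet_lt measurable_const (measurable_condMeasure (G.measurableSet_occurs w))

section Finite

variable [Finite V]

theorem measurableSet_stops (u : V) :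
    MeasurableSet {p : (V → PartialBits) × PartialBits | G.Stops p.1 u p.2} := by
  classical
  have h : {p : (V → PartialBits) × PartialBits | G.Stops p.1 u p.2} =
      ⋃ w : G.EventNode, ⋃ _ : G.graph.Adj u w.1,
        (fun p : (V → PartialBits) × PartialBits => Function.update p.1 u p.2) ⁻¹'
          {s | G.Dangerous s w} := by
    ext p
    simp only [Stops, Set.mem_ofPred_eq, Set.mem_iUnion, Set.mem_preimage, exists_prop]
  rw [h]
  exact .iUnion fun w => .iUnion fun _ => measurable_update' (G.measurableSet_dangerous w)

theorem measurable_fixNode (u : V) :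
    Measurable fun p : (V → PartialBits) × Bits => G.fixNode p.1 u p.2 := by
  classical
  have hr := measurable_revealBits (E := fun s => G.Stops s u) (G.measurableSet_stops u)
  have h := measurable_update' (X := fun _ : V => PartialBits) (a := u) |>.comp
    (measurable_fst.prodMk hr)
  convert h using 2
  simp only [fixNode, Function.comp_apply]

theorem measurable_fixNodes (l : List V) :
    Measurable fun p : (V → PartialBits) × (V → Bits) => G.fixNodes l p.1 p.2 := by
  induction l with
  | nil => exact measurable_fst
  | cons u l ih =>
    have hm : Measurable fun p : (V → PartialBits) × (V → Bits) => (p.1, p.2 u) :=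
      measurable_fst.prodMk ((measurable_pi_apply u).comp measurable_snd)
    exact ih.comp (((G.measurable_fixNode u).comp hm).prodMk measurable_snd)

theorem measurable_fixNodes_right (l : List V) (s : V → PartialBits) :
    Measurable (G.fixNodes l s) :=
  (G.measurable_fixNodes l).comp measurable_prodMk_left

theorem measurableSet_regular (u : V) :
    MeasurableSet {p : (V → PartialBits) × Bits | G.Regular p.1 u p.2} := by
  have hf : MeasurableSet {p : (V → PartialBits) × Bits | G.Stops p.1 u (fullBits p.2)} :=
    (measurable_fst.prodMk (measurable_fullBits.comp measurable_snd)) (G.measurableSet_stops u)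
  have hp : ∀ k, MeasurableSet
      {p : (V → PartialBits) × Bits | G.Stops p.1 u (prefixBits k p.2)} := fun k =>
    (measurable_fst.prodMk ((measurable_prefixBits k).comp measurable_snd))
      (G.measurableSet_stops u)
  have h : {p : (V → PartialBits) × Bits | G.Regular p.1 u p.2} =
      (⋃ k, {p : (V → PartialBits) × Bits | G.Stops p.1 u (prefixBits k p.2)}) ∪
        {p : (V → PartialBits) × Bits | G.Stops p.1 u (fullBits p.2)}ᶜ := by
    ext p
    simp only [Regular, Set.mem_ofPred_eq, Set.mem_union, Set.mem_iUnion, Set.mem_compl_iff]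
    rw [imp_iff_not_or]
    push Not
    rfl
  rw [h]
  exact (MeasurableSet.iUnion hp).union hf.compl

theorem measurableSet_regularRun (l : List V) :
    MeasurableSet {p : (V → PartialBits) × (V → Bits) | G.RegularRun l p.1 p.2} := by
  induction l with
  | nil => exact MeasurableSet.univ
  | cons u l ih =>
    have hm : Measurable fun p : (V → PartialBits) × (V → Bits) => (p.1, p.2 u) :=
      measurable_fst.prodMk ((measurable_pi_apply u).comp measurable_snd)
    exact (hm (G.measurableSet_regular u)).inter
      ((((G.measurable_fixNode u).comp hm).prodMk measurable_snd) ih)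

/-! #### The fixed bits are fair -/

/-- By Lévy's theorem the conditional probabilities given longer and longer prefixes converge almost
surely to the one given all bits. If all of them are at most the threshold, so is the limit. -/
theorem ae_regular (s : V → PartialBits) (u : V) :
    ∀ᵐ r ∂bitsMeasure, G.Regular s u r := by
  classical
  have h := fun w : G.EventNode => tendsto_lintegral_splice
    (measurable_condMeasure_update_fullBits s u (G.measurableSet_occurs w))
    fun r => condMeasure_le_one _ _
  filter_upwards [ae_all_iff.2 h] with r hr hpre
  rintro ⟨w, huw, hw⟩
  refine not_le_of_gt hw ?_
  convert le_of_tendsto' (hr w) fun k => ?_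
  · rw [← condMeasure_update_prefixBits s u k r (G.measurableSet_occurs w)]
    refine not_lt.1 fun hlt => hpre k ⟨w, huw, ?_⟩
    exact hlt

theorem lintegral_condMeasure_fixNode {s : V → PartialBits} {u : V} (hu : s u = fun _ => none)
    {A : Set (V → Bits)} (hA : MeasurableSet A) :
    ∫⁻ r, condMeasure (G.fixNode s u r) A ∂bitsMeasure = condMeasure s A := by
  classical
  have h := lintegral_revealBits (E := G.Stops s u)
    (W := fun x => condMeasure (Function.update s u x) A)
    (fun k => (measurable_const.prodMk (measurable_prefixBits k)) (G.measurableSet_stops u))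
    (G.ae_regular s u) (measurable_condMeasure_update_fullBits s u hA) (fun r => rfl)
    (fun k r => condMeasure_update_prefixBits s u k r hA)
  have h0 := condMeasure_update_prefixBits s u 0 (fun _ => false) hA
  simp only [splice_zero, prefixBits_zero, update_none_of_eq_none hu] at h0
  rw [h0, ← h]
  refine lintegral_congr fun r => ?_
  rw [fixNode]

/-- Optional stopping is iterated over the nodes; the stopping rule at a node may depend on all
earlier outcomes. The set `A` is arbitrary so that it can be an intersection of bad events. -/
theorem lintegral_condMeasure_fixNodes {l : List V} (hl : l.Nodup) {s : V → PartialBits}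
    (hs : ∀ u ∈ l, s u = fun _ => none) {A : Set (V → Bits)} (hA : MeasurableSet A) :
    ∫⁻ ρ, condMeasure (G.fixNodes l s ρ) A ∂bitsFamilyMeasure V = condMeasure s A := by
  classical
  induction l generalizing s with
  | nil => simp [fixNodes]
  | cons u l ih =>
    obtain ⟨hul, hl⟩ := List.nodup_cons.1 hl
    have hm : Measurable fun ρ => condMeasure (G.fixNodes (u :: l) s ρ) A :=
      (measurable_condMeasure hA).comp (G.measurable_fixNodes_right _ _)
    rw [bitsFamilyMeasure, ← lintegral_infinitePi_update _ u hm,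
      ← G.lintegral_condMeasure_fixNode (hs u (by simp)) hA]
    refine lintegral_congr fun r => ?_
    rw [← ih hl (s := G.fixNode s u r)]
    · refine lintegral_congr fun ρ => ?_
      rw [fixNodes, Function.update_self, G.fixNodes_update hul]
    · intro v hv
      rw [G.fixNode_of_ne _ (ne_of_mem_of_not_mem hv hul), hs v (List.mem_cons_of_mem _ hv)]

theorem ae_regularRun {l : List V} (hl : l.Nodup) (s : V → PartialBits) :
    ∀ᵐ ρ ∂bitsFamilyMeasure V, G.RegularRun l s ρ := by
  classical
  induction l generalizing s with
  | nil => exact .of_forall fun _ => trivial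
  | cons u l ih =>
    obtain ⟨hul, hl⟩ := List.nodup_cons.1 hl
    refine ae_bitsFamilyMeasure_of_update u
      (measurable_prodMk_left (G.measurableSet_regularRun (u :: l))) ?_
    filter_upwards [G.ae_regular s u] with r hr
    filter_upwards [ih hl (G.fixNode s u r)] with ρ hρ
    rw [RegularRun, Function.update_self, G.regularRun_update hul]
    exact ⟨hr, hρ⟩

end Finite

/-! #### What the fixed bits look like -/

theorem condMeasure_congr {s s' : V → PartialBits} {w : G.EventNode}
    (h : ∀ u, G.graph.Adj u w.1 → s u = s' u) :
    condMeasure s (G.occurs w) = condMeasure s' (G.occurs w) := by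
  refine congrArg (bitsFamilyMeasure V) (Set.ext fun ω => G.mem_occurs_congr fun u hu => ?_)
  funext i
  simp only [overrideBits, h u hu]

theorem dangerous_congr {s s' : V → PartialBits} {w : G.EventNode}
    (h : ∀ u, G.graph.Adj u w.1 → s u = s' u) : G.Dangerous s w ↔ G.Dangerous s' w := by
  rw [Dangerous, Dangerous, G.condMeasure_congr h]

theorem fixNode_of_stops {s : V → PartialBits} {u : V} (hu : s u = fun _ => none)
    (h : G.Stops s u fun _ => none) (r : Bits) : G.fixNode s u r = s := by
  classical
  rw [fixNode, revealBits_eq_prefixBits (k := 0) (by simpa using h) (by simp), prefixBits_zero,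
    update_none_of_eq_none hu]

variable {G} in
-- A variable of a dangerous event meets the stopping condition at the empty prefix and is left
-- untouched; other nodes do not affect the event.
theorem Dangerous.fixNode {s : V → PartialBits} {u : V} (hu : s u = fun _ => none)
    {w : G.EventNode} (h : G.Dangerous s w) (r : Bits) : G.Dangerous (G.fixNode s u r) w := by
  classical
  by_cases huw : G.graph.Adj u w.1
  · rwa [G.fixNode_of_stops hu ⟨w, huw, by rwa [update_none_of_eq_none hu]⟩]
  · refine (G.dangerous_congr fun v hv => ?_).1 h
    rw [G.fixNode_of_ne _ (by rintro rfl; exact huw hv)]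

theorem fixNode_eq_none {l : List V} {u : V} (hl : (u :: l).Nodup) {s : V → PartialBits}
    (hs : ∀ v ∈ u :: l, s v = fun _ => none) (r : Bits) :
    ∀ v ∈ l, G.fixNode s u r v = fun _ => none := by
  intro v hv
  rw [G.fixNode_of_ne _ (ne_of_mem_of_not_mem hv (List.nodup_cons.1 hl).1),
    hs v (List.mem_cons_of_mem _ hv)]

variable {G} in
theorem Dangerous.fixNodes {l : List V} (hl : l.Nodup) {s : V → PartialBits}
    (hs : ∀ u ∈ l, s u = fun _ => none) {w : G.EventNode} (h : G.Dangerous s w) (ρ : V → Bits) :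
    G.Dangerous (G.fixNodes l s ρ) w := by
  induction l generalizing s with
  | nil => exact h
  | cons u l ih =>
    exact ih hl.of_cons (G.fixNode_eq_none hl hs _) (h.fixNode (hs u (by simp)) _)

/-- Before the last revealed bit no adjacent event was dangerous, and that bit at most doubles the
value. If no bit is revealed the old bound is inherited, so no null set has to be excluded. -/
theorem condMeasure_fixNode_le {s : V → PartialBits} {u : V} (hu : s u = fun _ => none)
    {w : G.EventNode} (h : condMeasure s (G.occurs w) ≤ 2 * G.threshold w) (r : Bits) :
    condMeasure (G.fixNode s u r) (G.occurs w) ≤ 2 * G.threshold w := by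
  classical
  by_cases huw : G.graph.Adj u w.1
  · have hle : ∀ x, ¬ G.Stops s u x →
        condMeasure (Function.update s u x) (G.occurs w) ≤ G.threshold w := fun x hx =>
      not_lt.1 fun hlt => hx ⟨w, huw, hlt⟩
    rw [fixNode]
    rcases revealBits_cases (G.Stops s u) r with ⟨k, -, hlt, hk⟩ | ⟨-, hf, hk⟩ | ⟨-, -, hk⟩ <;>
      rw [hk]
    · rcases k with - | k
      · rwa [prefixBits_zero, update_none_of_eq_none hu]
      · have hA := G.measurableSet_occurs w
        refine le_trans ?_ (mul_le_mul_right (hle _ (hlt k (Nat.lt_succ_self k))) 2)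
        rw [condMeasure_update_prefixBits s u _ r hA, condMeasure_update_prefixBits s u _ r hA]
        exact lintegral_splice_succ_le k r (measurable_condMeasure_update_fullBits s u hA)
    · refine (hle _ hf).trans ?_
      rw [two_mul]
      exact le_add_right le_rfl
    · rwa [update_none_of_eq_none hu]
  · rwa [G.condMeasure_congr fun v hv => G.fixNode_of_ne _ (by rintro rfl; exact huw hv)]

theorem condMeasure_fixNodes_le {l : List V} (hl : l.Nodup) {s : V → PartialBits}
    (hs : ∀ u ∈ l, s u = fun _ => none) {w : G.EventNode}
    (h : condMeasure s (G.occurs w) ≤ 2 * G.threshold w) (ρ : V → Bits) :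
    condMeasure (G.fixNodes l s ρ) (G.occurs w) ≤ 2 * G.threshold w := by
  induction l generalizing s with
  | nil => exact h
  | cons u l ih =>
    exact ih hl.of_cons (G.fixNode_eq_none hl hs _)
      (G.condMeasure_fixNode_le (hs u (by simp)) h _)

/-- After a regular run, all bits are fixed at the nodes that have no dangerous neighbor. -/
theorem RegularRun.exists_dangerous_or_full {l : List V} (hl : l.Nodup) {s : V → PartialBits}
    (hs : ∀ u ∈ l, s u = fun _ => none) {ρ : V → Bits} (h : G.RegularRun l s ρ) {u : V}
    (hu : u ∈ l) :
    (∃ w : G.EventNode, G.graph.Adj u w.1 ∧ G.Dangerous (G.fixNodes l s ρ) w) ∨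
      ∃ r, G.fixNodes l s ρ u = fullBits r := by
  classical
  induction l generalizing s with
  | nil => simp at hu
  | cons v l ih =>
    have hs' := G.fixNode_eq_none hl hs (ρ v)
    rcases List.mem_cons.1 hu with rfl | hu
    · rcases revealBits_cases (G.Stops s u) (ρ u) with ⟨k, hk, -, hr⟩ | ⟨-, -, hr⟩ | ⟨hlt, hf, -⟩
      · obtain ⟨w, huw, hw⟩ := hk
        refine Or.inl ⟨w, huw, Dangerous.fixNodes hl.of_cons hs' ?_ ρ⟩
        rw [VEGraph.fixNode, hr]
        exact hw
      · refine Or.inr ⟨ρ u, ?_⟩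
        rw [VEGraph.fixNodes, G.fixNodes_of_notMem (List.nodup_cons.1 hl).1, VEGraph.fixNode,
          Function.update_self, hr]
      · exact absurd hf (h.1 hlt)
    · exact ih hl.of_cons hs' h.2 hu

/-- After a regular run, an event that is still possible is dangerous or has a dangerous
neighbor. -/
theorem RegularRun.exists_dangerous {l : List V} (hl : l.Nodup) (hmem : ∀ u, u ∈ l)
    {ρ : V → Bits} (h : G.RegularRun l (fun _ _ => none) ρ) {w : G.EventNode}
    (hw1 : G.threshold w < 1)
    (hw : condMeasure (G.fixNodes l (fun _ _ => none) ρ) (G.occurs w) ≠ 0) :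
    ∃ w', (w = w' ∨ G.dependencyGraph.Adj w w') ∧
      G.Dangerous (G.fixNodes l (fun _ _ => none) ρ) w' := by
  by_cases hfull : ∀ u, G.graph.Adj u w.1 →
      ∃ r, G.fixNodes l (fun _ _ => none) ρ u = fullBits r
  · refine ⟨w, Or.inl rfl, ?_⟩
    -- With all its variables fixed, the event either surely happens or surely fails; the latter
    -- contradicts `hw`.
    have hone : condMeasure (G.fixNodes l (fun _ _ => none) ρ) (G.occurs w) = 1 := by
      have hne : {ω | overrideBits (G.fixNodes l (fun _ _ => none) ρ) ω ∈ G.occurs w} ≠ ∅ :=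
        fun he => hw (by rw [condMeasure, he, measure_empty])
      obtain ⟨ω₀, hω₀⟩ := Set.nonempty_iff_ne_empty.2 hne
      have huniv :
          {ω | overrideBits (G.fixNodes l (fun _ _ => none) ρ) ω ∈ G.occurs w} = Set.univ := by
        refine Set.eq_univ_of_forall fun ω => ?_
        refine (G.mem_occurs_congr fun u hu => ?_).1 hω₀
        obtain ⟨r, hr⟩ := hfull u hu
        funext i
        simp [overrideBits, hr, fullBits]
      rw [condMeasure, huniv, measure_univ]
    rw [Dangerous, hone]
    exact hw1
  · push Not at hfull
    obtain ⟨u, huw, hu⟩ := hfull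
    rcases RegularRun.exists_dangerous_or_full G hl (fun _ _ => rfl) h (hmem u) with
      ⟨w', huw', hw'⟩ | ⟨r, hr⟩
    · refine ⟨w', ?_, hw'⟩
      by_cases hww : w = w'
      · exact Or.inl hww
      · exact Or.inr ⟨hww, u, huw, huw'⟩
    · exact absurd hr (hu r)

/-! #### Dangerous events are rare -/

theorem bitsFamilyMeasure_occurs_le_threshold (w : G.EventNode) :
    bitsFamilyMeasure V (G.occurs w) ≤ G.threshold w := by
  conv_lhs => rw [← ENNReal.rpow_one (bitsFamilyMeasure V (G.occurs w))]
  exact ENNReal.rpow_le_rpow_of_exponent_ge prob_le_one (by norm_num)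

/-- This is why the threshold is a square root: Markov's bound on the chance of exceeding it is
again the threshold. For null events `0 / 0 = 0` in `ENNReal`. -/
theorem div_threshold_le (w : G.EventNode) :
    bitsFamilyMeasure V (G.occurs w) / G.threshold w ≤ G.threshold w := by
  refine ENNReal.div_le_of_le_mul ?_
  rw [threshold, ← ENNReal.rpow_add_of_nonneg _ _ (by norm_num) (by norm_num)]
  norm_num

/-- Events without common variables are independent, conditioned on any fixed bits. -/
theorem condMeasure_biInter {W : Finset G.EventNode}
    (hW : ∀ v ∈ W, ∀ w ∈ W, ¬ G.dependencyGraph.Adj v w) (s : V → PartialBits) :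
    condMeasure s (⋂ w ∈ W, G.occurs w) = ∏ w ∈ W, condMeasure s (G.occurs w) := by
  classical
  induction W using Finset.induction_on with
  | empty => simp [condMeasure]
  | insert w W hw ih =>
    rw [Finset.prod_insert hw, ← ih fun v hv v' hv' =>
      hW v (Finset.mem_insert_of_mem hv) v' (Finset.mem_insert_of_mem hv')]
    have h : {ω | overrideBits s ω ∈ ⋂ v ∈ insert w W, G.occurs v} =
        {ω | overrideBits s ω ∈ G.occurs w} ∩ {ω | overrideBits s ω ∈ ⋂ v ∈ W, G.occurs v} := by
      ext ω
      simp
    rw [condMeasure, h]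
    refine infinitePi_inter_of_disjoint _ {u | G.graph.Adj u w.1}
      (measurable_overrideBits_right s (G.measurableSet_occurs w))
      (measurable_overrideBits_right s
        (W.measurableSet_biInter fun v _ => G.measurableSet_occurs v)) ?_ ?_
    · intro x y hxy
      refine G.mem_occurs_congr fun u hu => ?_
      funext i
      rw [overrideBits, overrideBits, hxy u hu]
    · intro x y hxy
      simp only [Set.mem_ofPred_eq, Set.mem_iInter]
      refine forall₂_congr fun v hv => G.mem_occurs_congr fun u hu => ?_
      have huw : ¬ G.graph.Adj u w.1 := fun huw =>
        hW w (Finset.mem_insert_self _ _) v (Finset.mem_insert_of_mem hv)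
          ⟨fun h => hw (h ▸ hv), u, huw, hu⟩
      funext i
      rw [overrideBits, overrideBits, hxy u huw]

/-- The dangers themselves need not be independent, since the run couples them. Markov's inequality
is applied instead to the product of the ratios of conditional probability to threshold, whose mean
is known by `condMeasure_biInter` and optional stopping. -/
theorem measure_dangerous_le [Finite V] {l : List V} (hl : l.Nodup) {W : Finset G.EventNode}
    (hW : ∀ v ∈ W, ∀ w ∈ W, ¬ G.dependencyGraph.Adj v w) :
    bitsFamilyMeasure V {ρ | ∀ w ∈ W, G.Dangerous (G.fixNodes l (fun _ _ => none) ρ) w} ≤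
      ∏ w ∈ W, G.threshold w := by
  set f : (V → Bits) → V → PartialBits := G.fixNodes l fun _ _ => none with hf
  have hfm : Measurable f := G.measurable_fixNodes_right _ _
  have hcm : ∀ w, Measurable fun ρ => condMeasure (f ρ) (G.occurs w) := fun w =>
    (measurable_condMeasure (G.measurableSet_occurs w)).comp hfm
  have hDm : MeasurableSet {ρ | ∀ w ∈ W, G.Dangerous (f ρ) w} := by
    have : {ρ | ∀ w ∈ W, G.Dangerous (f ρ) w} = ⋂ w ∈ W, f ⁻¹' {s | G.Dangerous s w} := by
      ext ρ; simp
    rw [this]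
    exact W.measurableSet_biInter fun w _ => hfm (G.measurableSet_dangerous w)
  calc _ = ∫⁻ ρ, {ρ | ∀ w ∈ W, G.Dangerous (f ρ) w}.indicator 1 ρ ∂bitsFamilyMeasure V :=
        (lintegral_indicator_one hDm).symm
    _ ≤ ∫⁻ ρ, ∏ w ∈ W, condMeasure (f ρ) (G.occurs w) / G.threshold w ∂bitsFamilyMeasure V := by
        refine lintegral_mono fun ρ => Set.indicator_apply_le
          (g := fun ρ => ∏ w ∈ W, condMeasure (f ρ) (G.occurs w) / G.threshold w) fun hρ => ?_
        refine Finset.one_le_prod' fun w hw => ?_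
        have hd : G.threshold w < condMeasure (f ρ) (G.occurs w) := hρ w hw
        rw [ENNReal.le_div_iff_mul_le (Or.inr (pos_of_gt hd).ne')
          (Or.inr ((condMeasure_le_one _ _).trans_lt ENNReal.one_lt_top).ne), one_mul]
        exact hd.le
    _ = ∏ w ∈ W, bitsFamilyMeasure V (G.occurs w) / G.threshold w := by
        simp_rw [div_eq_mul_inv, Finset.prod_mul_distrib]
        rw [lintegral_mul_const _ (Finset.measurable_prod _ fun w _ => hcm w)]
        simp_rw [← condMeasure_none, ← G.condMeasure_biInter hW]
        rw [hf, G.lintegral_condMeasure_fixNodes hl (fun _ _ => rfl)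
          (W.measurableSet_biInter fun w _ => G.measurableSet_occurs w)]
    _ ≤ _ := Finset.prod_le_prod' fun w _ => G.div_threshold_le w

end VEGraph

/-! ### The algorithm -/

/-- Events that depend on the coordinates in `B` only, and in the same way, have the same
probability. -/
theorem bitsFamilyMeasure_eq_of_local {V V' B : Type} {j : B → V} {j' : B → V'}
    (hj : Function.Injective j) (hj' : Function.Injective j') {A : Set (V → Bits)}
    {A' : Set (V' → Bits)} (hA : MeasurableSet A)
    (h : ∀ ω ω', (∀ b, ω (j b) = ω' (j' b)) → (ω ∈ A ↔ ω' ∈ A')) :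
    bitsFamilyMeasure V A = bitsFamilyMeasure V' A' := by
  classical
  set ext : (B → Bits) → V → Bits := fun x => Function.extend j x fun _ _ => false with hext
  set ext' : (B → Bits) → V' → Bits := fun x => Function.extend j' x fun _ _ => false with hext'
  have hm : Measurable ext := by
    refine measurable_pi_lambda _ fun v => ?_
    by_cases hv : ∃ b, j b = v
    · obtain ⟨b, rfl⟩ := hv
      simp only [hext, hj.extend_apply]
      exact measurable_pi_apply b
    · simp only [hext, Function.extend_apply' _ _ _ hv]
      exact measurable_const
  have hr : ∀ {U : Type} {i : B → U}, Function.Injective i →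
      bitsFamilyMeasure B (ext ⁻¹' A) =
        bitsFamilyMeasure U ((fun ω b => ω (i b)) ⁻¹' (ext ⁻¹' A)) := by
    intro U i hi
    rw [← Measure.map_apply (by fun_prop) (hm hA), bitsFamilyMeasure, bitsFamilyMeasure,
      Measure.map_infinitePi_infinitePi_of_inj (P := fun _ : U => bitsMeasure) hi]
  have e : (fun (ω : V → Bits) b => ω (j b)) ⁻¹' (ext ⁻¹' A) = A := by
    ext ω
    -- Since `h` only compares samples on different spaces, a detour through `A'` is needed to see
    -- that `A` ignores the coordinates outside `B`.
    have h₁ := h ω (ext' fun b => ω (j b)) fun b => by simp [hext', hj'.extend_apply]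
    have h₂ := h (ext fun b => ω (j b)) (ext' fun b => ω (j b)) fun b => by
      simp [hext, hext', hj.extend_apply, hj'.extend_apply]
    exact h₂.trans h₁.symm
  have e' : (fun (ω : V' → Bits) b => ω (j' b)) ⁻¹' (ext ⁻¹' A) = A' := by
    ext ω
    exact h (ext fun b => ω (j' b)) ω fun b => by simp [hext, hj.extend_apply]
  rw [← e, ← hr hj, hr hj', e']

/-- The bits fixed by the outputs. -/
def outputBits {V : Type} (σ : V → Option (PartialBits × Unit)) : V → PartialBits :=
  fun u => ((σ u).map Prod.fst).getD fun _ => none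

/-- Radius 2 suffices: the events adjacent to `u` are at distance 1, so their labels are visible,
and their variables, with the bits already fixed there, are at distance at most 2. Labels also
determine the thresholds. -/
theorem SameNeighborhood.stops_iff {V V' : Type} {G : VEGraph V} {G' : VEGraph V'}
    {σ : V → Option (PartialBits × Unit)} {σ' : V' → Option (PartialBits × Unit)} {u : V} {u' : V'}
    (h : SameNeighborhood 2 G σ u G' σ' u') (x : PartialBits) :
    G.Stops (outputBits σ) u x ↔ G'.Stops (outputBits σ') u' x := by
  classical
  obtain ⟨φ, hroot, hadj, hev, hσ, hocc⟩ := h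
  have hdist : ∀ {U : Type} (H : SimpleGraph U) {a b : U}, H.Adj a b →
      H.edist a b < ((2 : ℕ) : ℕ∞) := by
    intro U H a b hab
    rw [SimpleGraph.edist_eq_one_iff_adj.2 hab]
    norm_num
  set root : G.Ball u 2 := ⟨u, by simp⟩ with hrootdef
  have hφroot : (φ root).1 = u' := hroot root rfl
  have hφne : ∀ b : G.Ball u 2, b.1 ≠ u → (φ b).1 ≠ u' := by
    intro b hb hb'
    have : φ b = φ root := Subtype.ext (hb'.trans hφroot.symm)
    exact hb (congrArg Subtype.val (φ.injective this))
  have hcond : ∀ (a : G.Ball u 2) (ha : G.IsEvent a.1) (ha' : G'.IsEvent (φ a).1),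
      G.graph.Adj u a.1 → ∀ (s : V → PartialBits) (s' : V' → PartialBits),
      (∀ b : G.Ball u 2, s b.1 = s' (φ b).1) →
      condMeasure s (G.occurs ⟨a.1, ha⟩) = condMeasure s' (G'.occurs ⟨(φ a).1, ha'⟩) := by
    intro a ha ha' hua s s' hs
    refine bitsFamilyMeasure_eq_of_local (j := fun b : G.Ball u 2 => b.1)
      (j' := fun b => (φ b).1) Subtype.val_injective
      (Subtype.val_injective.comp φ.injective)
      (measurable_overrideBits_right s (G.measurableSet_occurs _)) fun ω ω' hω => ?_
    refine hocc a ha ha' (hdist _ hua) _ _ fun b => ?_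
    funext i
    rw [overrideBits, overrideBits, hs b, hω b]
  have hdang : ∀ (a : G.Ball u 2) (ha : G.IsEvent a.1) (ha' : G'.IsEvent (φ a).1),
      G.graph.Adj u a.1 →
      (G.Dangerous (Function.update (outputBits σ) u x) ⟨a.1, ha⟩ ↔
        G'.Dangerous (Function.update (outputBits σ') u' x) ⟨(φ a).1, ha'⟩) := by
    intro a ha ha' hua
    have h₁ := hcond a ha ha' hua (fun _ _ => none) (fun _ _ => none) fun _ => rfl
    have h₂ := hcond a ha ha' hua (Function.update (outputBits σ) u x)
      (Function.update (outputBits σ') u' x) fun b => by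
        by_cases hb : b.1 = u
        · rw [hb, hroot b hb, Function.update_self, Function.update_self]
        · rw [Function.update_of_ne hb, Function.update_of_ne (hφne b hb), outputBits, outputBits,
            hσ b]
    rw [condMeasure_none, condMeasure_none] at h₁
    rw [VEGraph.Dangerous, VEGraph.Dangerous, VEGraph.threshold, VEGraph.threshold, h₁, h₂]
  have hadj' : ∀ a : G.Ball u 2, G.graph.Adj u a.1 ↔ G'.graph.Adj u' (φ a).1 := by
    intro a
    have h := hadj root a
    rwa [hφroot] at h
  constructor
  · rintro ⟨w, huw, hw⟩
    set a : G.Ball u 2 := ⟨w.1, (hdist _ huw).le⟩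
    exact ⟨⟨(φ a).1, (hev a).1 w.2⟩, (hadj' a).1 huw,
      by convert (hdang a w.2 ((hev a).1 w.2) huw).1 (by convert hw)⟩
  · rintro ⟨w, huw, hw⟩
    obtain ⟨a, ha⟩ := φ.surjective ⟨w.1, (hdist _ huw).le⟩
    have haw : (φ a).1 = w.1 := congrArg Subtype.val ha
    have hE' : G'.IsEvent (φ a).1 := haw ▸ w.2
    have hE : G.IsEvent a.1 := (hev a).2 hE'
    have hua : G.graph.Adj u a.1 := (hadj' a).2 (haw ▸ huw)
    obtain rfl : w = ⟨(φ a).1, hE'⟩ := Subtype.ext haw.symm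
    exact ⟨⟨a.1, hE⟩, hua, by convert (hdang a hE hE' hua).2 (by convert hw)⟩

/-- The algorithm that fixes the bits of a node one after another, as long as all events that
involve the node have a small conditional probability. -/
noncomputable def bitFixingAlgorithm : RandSeqLocalAlgorithm (fun _ => 2) PartialBits where
  Mem := Unit
  step _ _ _ G σ u r := (revealBits (G.Stops (outputBits σ) u) r, ())
  local_step _ _ _ _ _ G G' σ σ' u u' r h := by
    have : G.Stops (outputBits σ) u = G'.Stops (outputBits σ') u' :=
      funext fun x => propext (h.stops_iff x)
    simp only [this]

theorem bitFixingAlgorithm_fixedBits {V : Type} [Finite V] (G : VEGraph V) (ρ : V → Bits)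
    (order : List V) :
    bitFixingAlgorithm.fixedBits G ρ order = G.fixNodes order (fun _ _ => none) ρ := by
  classical
  have key : ∀ (l : List V) (σ : V → Option (PartialBits × Unit)),
      outputBits (l.foldl (fun σ u => Function.update σ u
        (some (revealBits (G.Stops (outputBits σ) u) (ρ u), ()))) σ) =
      G.fixNodes l (outputBits σ) ρ := by
    intro l
    induction l with
    | nil => intro σ; rfl
    | cons u l ih =>
      intro σ
      rw [List.foldl_cons, ih, VEGraph.fixNodes]
      congr 1
      funext v
      by_cases hv : v = u
      · subst hv; simp [outputBits, VEGraph.fixNode]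
      · simp [outputBits, VEGraph.fixNode, hv]
  exact key order fun _ => none

/-! ### Large components contain many far apart marked vertices -/

namespace SimpleGraph

variable {U : Type*} (H : SimpleGraph U)

/-- The vertices that are joined by paths of length at most `k`. -/
def nearGraph (k : ℕ) : SimpleGraph U where
  Adj v w := v ≠ w ∧ H.edist v w ≤ k
  symm := ⟨fun _ _ h => ⟨h.1.symm, by rw [edist_comm]; exact h.2⟩⟩
  loopless := ⟨fun _ h => h.1 rfl⟩

theorem edist_le_one_of_adj {v w : U} (h : H.Adj v w) : H.edist v w ≤ 1 :=
  (edist_eq_one_iff_adj.2 h).le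

theorem exists_adj_of_edist_le_succ {v w : U} {k : ℕ} (h : H.edist v w ≤ (k + 1 : ℕ)) :
    v = w ∨ ∃ x, H.Adj v x ∧ H.edist x w ≤ k := by
  obtain ⟨p, hp⟩ := exists_walk_of_edist_ne_top
    (ne_top_of_le_ne_top (ENat.natCast_ne_top (k + 1)) h)
  rw [← hp, Nat.cast_le] at h
  cases p with
  | nil => exact Or.inl rfl
  | cons hadj q =>
    refine Or.inr ⟨_, hadj, (edist_le q).trans ?_⟩
    rw [Walk.length_cons] at h
    exact_mod_cast Nat.le_of_succ_le_succ h

theorem ncard_edist_le [Finite U] {Δ : ℕ} (hΔ : ∀ v, (H.neighborSet v).ncard ≤ Δ) (k : ℕ) (v : U) :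
    {w | H.edist v w ≤ k}.ncard ≤ (Δ + 1) ^ k := by
  classical
  induction k generalizing v with
  | zero => simp [edist_eq_zero_iff]
  | succ k ih =>
    have := Fintype.ofFinite U
    have hsub : {w | H.edist v w ≤ (k + 1 : ℕ)} ⊆
        ⋃ x ∈ (insert v (H.neighborSet v)).toFinset, {w | H.edist x w ≤ k} := by
      intro w hw
      simp only [Set.mem_iUnion, Set.mem_toFinset, exists_prop]
      rcases H.exists_adj_of_edist_le_succ hw with rfl | ⟨x, hx, hxw⟩
      · exact ⟨v, Set.mem_insert _ _, by simp⟩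
      · exact ⟨x, Set.mem_insert_of_mem _ hx, hxw⟩
    calc _ ≤ _ := Set.ncard_le_ncard hsub (Set.toFinite _)
      _ ≤ ∑ x ∈ (insert v (H.neighborSet v)).toFinset, {w | H.edist x w ≤ k}.ncard :=
        Finset.set_ncard_biUnion_le _ _
      _ ≤ (insert v (H.neighborSet v)).toFinset.card * (Δ + 1) ^ k :=
        Finset.sum_le_card_nsmul _ _ _ fun x _ => ih x
      _ ≤ (Δ + 1) * (Δ + 1) ^ k := by
        gcongr
        rw [← Set.ncard_eq_toFinset_card']
        exact (Set.ncard_insert_le _ _).trans (Nat.add_le_add_right (hΔ v) 1)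
      _ = _ := (pow_succ' _ _).symm

/-- In a component of the graph induced by a set `R`, all of whose vertices are in or next to `X`,
there are `i + 1` independent vertices of `X` on a closed walk of length `2 * i` whose steps have
length at most `4`, unless the component is small. -/
theorem exists_walk_of_lt_ncard_supp [Finite U] [DecidableEq U] {Δ : ℕ}
    (hΔ : ∀ v, (H.neighborSet v).ncard ≤ Δ) {R X : Set U}
    (hRX : ∀ y ∈ R, ∃ x ∈ X, H.edist y x ≤ 1) (C : (H.induce R).ConnectedComponent) (i : ℕ)
    (hi : i * (Δ + 1) ^ 2 < C.supp.ncard) :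
    ∃ (v : U) (p : (H.nearGraph 4).Walk v v), p.length = 2 * i ∧
      p.support.toFinset.card = i + 1 ∧
      (∀ x ∈ p.support, ∀ y ∈ p.support, ¬ H.Adj x y) ∧ (∀ x ∈ p.support, x ∈ X) ∧
      ∃ y ∈ C.supp, ∃ x ∈ p.support, H.edist y.1 x ≤ 2 := by
  induction i with
  | zero =>
    obtain ⟨y, hy⟩ := Set.nonempty_of_ncard_ne_zero (Nat.ne_of_gt (by simpa using hi))
    obtain ⟨x, hx, hyx⟩ := hRX y.1 y.2
    exact ⟨x, .nil, by simp, by simp, by simp, by simpa using hx, y, hy, x, by simp,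
      hyx.trans (by norm_num)⟩
  | succ i ih =>
    obtain ⟨v, p, hlen, hcard, hind, hX, y₀, hy₀, x₀, hx₀, hyx₀⟩ :=
      ih (lt_of_le_of_lt (Nat.mul_le_mul_right _ (Nat.le_succ i)) hi)
    set P : Set R := {y | ∃ x ∈ p.support, H.edist y.1 x ≤ 2} with hP
    -- The `i + 1` vertices of the walk have at most `(i + 1) * (Δ + 1) ^ 2` vertices within
    -- distance 2, too few to cover the component.
    obtain ⟨y₁, hy₁, hy₁P⟩ : ∃ y ∈ C.supp, y ∉ P := by
      by_contra! hall
      refine hi.not_ge ?_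
      have hsub : Subtype.val '' C.supp ⊆
          ⋃ x ∈ p.support.toFinset, {y | H.edist x y ≤ (2 : ℕ)} := by
        rintro _ ⟨y, hy, rfl⟩
        obtain ⟨x, hx, hyx⟩ := hall y hy
        simp only [Set.mem_iUnion, List.mem_toFinset, exists_prop]
        exact ⟨x, hx, by rw [Set.mem_ofPred_eq, edist_comm]; exact hyx⟩
      rw [← Set.ncard_image_of_injective C.supp Subtype.val_injective]
      calc _ ≤ _ := Set.ncard_le_ncard hsub (Set.toFinite _)
        _ ≤ ∑ x ∈ p.support.toFinset, {y | H.edist x y ≤ (2 : ℕ)}.ncard :=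
          Finset.set_ncard_biUnion_le _ _
        _ ≤ p.support.toFinset.card * (Δ + 1) ^ 2 :=
          Finset.sum_le_card_nsmul _ _ _ fun x _ => H.ncard_edist_le hΔ 2 x
        _ = _ := by rw [hcard]
    obtain ⟨q⟩ : (H.induce R).Reachable y₀ y₁ := by
      rw [ConnectedComponent.mem_supp_iff] at hy₀ hy₁
      exact ConnectedComponent.exact (hy₀.trans hy₁.symm)
    -- Leave the region `P` along a path in the component. The first vertex outside has a marked `x`
    -- within distance 1, which is therefore not within distance 1 of the walk but is within `2 + 1
    -- + 1 = 4` of some `w` on it.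
    obtain ⟨d, -, ⟨w, hw, hdw⟩, hdP⟩ := q.exists_boundary_dart P ⟨x₀, hx₀, hyx₀⟩ hy₁P
    have hdadj : H.Adj d.fst.1 d.snd.1 := d.adj
    obtain ⟨x, hx, hdx⟩ := hRX d.snd.1 d.snd.2
    have hfar : ∀ z ∈ p.support, ¬ H.edist x z ≤ 1 := by
      intro z hz hxz
      refine hdP ⟨z, hz, SimpleGraph.edist_triangle.trans ((add_le_add hdx hxz).trans ?_)⟩
      norm_num
    have hxp : x ∉ p.support := fun h => hfar x h (by simp)
    have hwx : (H.nearGraph 4).Adj w x := by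
      refine ⟨ne_of_mem_of_not_mem hw hxp, ?_⟩
      have h₁ : H.edist w d.fst.1 ≤ 2 := by rwa [edist_comm]
      have h₂ := H.edist_le_one_of_adj hdadj
      have h₃ : H.edist w d.snd.1 ≤ 2 + 1 := SimpleGraph.edist_triangle.trans (add_le_add h₁ h₂)
      refine SimpleGraph.edist_triangle.trans ((add_le_add h₃ hdx).trans ?_)
      norm_num
    -- The new walk inserts the detour from `w` to `x` and back, which adds one vertex and two
    -- steps, as in a traversal of a tree.
    have hmem : ∀ z, z ∈ ((p.takeUntil w hw).append
        (.cons hwx (.cons hwx.symm (p.dropUntil w hw)))).support ↔ z = x ∨ z ∈ p.support := by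
      intro z
      conv_rhs => rw [← p.take_spec hw, Walk.mem_support_append_iff]
      have := (p.takeUntil w hw).end_mem_support
      rw [Walk.mem_support_append_iff, Walk.support_cons, Walk.support_cons, List.mem_cons,
        List.mem_cons]
      constructor
      · rintro (h | rfl | h | h)
        · exact Or.inr (Or.inl h)
        · exact Or.inr (Or.inl this)
        · exact Or.inl h
        · exact Or.inr (Or.inr h)
      · rintro (h | h | h)
        · exact Or.inr (Or.inr (Or.inl h))
        · exact Or.inl h
        · exact Or.inr (Or.inr (Or.inr h))
    refine ⟨v, (p.takeUntil w hw).append (.cons hwx (.cons hwx.symm (p.dropUntil w hw))),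
      ?_, ?_, ?_, ?_, y₀, hy₀, x₀, (hmem _).2 (Or.inr hx₀), hyx₀⟩
    · have h := congrArg Walk.length (p.take_spec hw)
      rw [Walk.length_append] at h
      rw [Walk.length_append, Walk.length_cons, Walk.length_cons]
      omega
    · have : ((p.takeUntil w hw).append
          (.cons hwx (.cons hwx.symm (p.dropUntil w hw)))).support.toFinset =
          insert x p.support.toFinset := by
        ext z
        rw [List.mem_toFinset, hmem, Finset.mem_insert, List.mem_toFinset]
      rw [this, Finset.card_insert_of_notMem (by simpa using hxp), hcard]
    · intro a ha b hb hab
      rcases (hmem a).1 ha with rfl | ha' <;> rcases (hmem b).1 hb with rfl | hb'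
      · exact hab.ne rfl
      · exact hfar b hb' (H.edist_le_one_of_adj hab)
      · exact hfar a ha' (H.edist_le_one_of_adj hab.symm)
      · exact hind a ha' b hb' hab
    · intro z hz
      rcases (hmem z).1 hz with rfl | hz
      · exact hx
      · exact hX z hz

/-- The vertex sets of walks of length `m` from `v`. -/
noncomputable def walkSupports [Fintype U] [DecidableEq U] [DecidableRel H.Adj] :
    ℕ → U → Finset (Finset U)
  | 0, v => {{v}}
  | m + 1, v => (H.neighborFinset v).biUnion fun x => (walkSupports m x).image (insert v)

theorem Walk.support_mem_walkSupports {H : SimpleGraph U} [Fintype U] [DecidableEq U]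
    [DecidableRel H.Adj] {v w : U} (p : H.Walk v w) :
    p.support.toFinset ∈ H.walkSupports p.length v := by
  induction p with
  | nil => simp [walkSupports]
  | cons h p ih =>
    rw [Walk.length_cons, walkSupports, Finset.mem_biUnion]
    refine ⟨_, (H.mem_neighborFinset _ _).2 h, Finset.mem_image.2 ⟨_, ih, ?_⟩⟩
    rw [Walk.support_cons, List.toFinset_cons]

theorem card_walkSupports_le [Fintype U] [DecidableEq U] [DecidableRel H.Adj] {D : ℕ}
    (hD : ∀ v, H.degree v ≤ D) (m : ℕ) (v : U) : (H.walkSupports m v).card ≤ D ^ m := by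
  induction m generalizing v with
  | zero => simp [walkSupports]
  | succ m ih =>
    rw [walkSupports, pow_succ']
    refine (Finset.card_biUnion_le_card_mul _ _ (D ^ m) fun x _ =>
      Finset.card_image_le.trans (ih x)).trans ?_
    exact Nat.mul_le_mul_right _ (hD v)

theorem degree_nearGraph_le [Fintype U] {Δ : ℕ} (hΔ : ∀ v, (H.neighborSet v).ncard ≤ Δ) (k : ℕ)
    [DecidableRel (H.nearGraph k).Adj] (v : U) : (H.nearGraph k).degree v ≤ (Δ + 1) ^ k := by
  refine le_trans ?_ (H.ncard_edist_le hΔ k v)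
  rw [← card_neighborFinset_eq_degree, ← Set.ncard_coe_finset]
  refine Set.ncard_le_ncard (fun w hw => ?_) (Set.toFinite _)
  have : (H.nearGraph k).Adj v w := by simpa using hw
  exact this.2

end SimpleGraph

/-! ### Components of the residual graph are small -/

namespace VEGraph

variable {V : Type} (G : VEGraph V)

theorem condProb_eq_toReal (s : V → PartialBits) (w : G.EventNode) :
    G.condProb s w = (condMeasure s (G.occurs w)).toReal := rfl

/-- A union bound over the supports of walks: the starting vertex, then `2 * i` choices among at
most `(Δ + 1) ^ 4` neighbors, each support having `i + 1` nonadjacent dangerous events. Irregular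
runs have measure zero. -/
theorem measure_exists_large_component_le [Finite V] {Δ : ℕ}
    (hΔ : ∀ v : G.EventNode, (G.dependencyGraph.neighborSet v).ncard ≤ Δ) {q : ENNReal}
    (hq : ∀ w, G.threshold w ≤ q) (hq1 : q < 1) {l : List V} (hl : l.Nodup) (hmem : ∀ v, v ∈ l)
    (i : ℕ) :
    bitsFamilyMeasure V {ρ | ∃ C : (G.residualGraph
        (G.fixNodes l (fun _ _ => none) ρ)).ConnectedComponent,
        i * (Δ + 1) ^ 2 < C.supp.ncard} ≤
      Nat.card V * ((Δ + 1) ^ 4) ^ (2 * i) * q ^ (i + 1) := by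
  classical
  have := Fintype.ofFinite G.EventNode
  set N := G.dependencyGraph.nearGraph 4
  set F : Finset (Finset G.EventNode) :=
    (Finset.univ.biUnion fun v => N.walkSupports (2 * i) v).filter fun W =>
      W.card = i + 1 ∧ ∀ v ∈ W, ∀ w ∈ W, ¬ G.dependencyGraph.Adj v w with hF
  have hFcard : F.card ≤ Nat.card V * ((Δ + 1) ^ 4) ^ (2 * i) := by
    refine (Finset.card_filter_le _ _).trans ((Finset.card_biUnion_le_card_mul _ _ _ fun v _ =>
      N.card_walkSupports_le (G.dependencyGraph.degree_nearGraph_le hΔ 4) (2 * i) v).trans ?_)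
    refine Nat.mul_le_mul_right _ ?_
    rw [Finset.card_univ, ← Nat.card_eq_fintype_card]
    exact Finite.card_subtype_le _
  have hsub : {ρ | ∃ C : (G.residualGraph
        (G.fixNodes l (fun _ _ => none) ρ)).ConnectedComponent, i * (Δ + 1) ^ 2 < C.supp.ncard} ⊆
      {ρ | ¬ G.RegularRun l (fun _ _ => none) ρ} ∪
        ⋃ W ∈ F, {ρ | ∀ w ∈ W, G.Dangerous (G.fixNodes l (fun _ _ => none) ρ) w} := by
    rintro ρ ⟨C, hC⟩
    by_cases hreg : G.RegularRun l (fun _ _ => none) ρ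
    · right
      obtain ⟨v, p, hlen, hcard, hind, hX, -⟩ :=
        G.dependencyGraph.exists_walk_of_lt_ncard_supp hΔ
          (R := {v | G.condProb (G.fixNodes l (fun _ _ => none) ρ) v ≠ 0})
          (X := {w | G.Dangerous (G.fixNodes l (fun _ _ => none) ρ) w}) (fun y hy => by
            obtain ⟨x, hyx, hx⟩ := hreg.exists_dangerous G hl hmem
              ((hq y).trans_lt hq1) (w := y) fun h0 => hy (by rw [condProb_eq_toReal, h0]; rfl)
            refine ⟨x, hx, ?_⟩
            rcases hyx with rfl | hyx
            · simp
            · exact G.dependencyGraph.edist_le_one_of_adj hyx) C i hC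
      simp only [Set.mem_iUnion, exists_prop]
      refine ⟨p.support.toFinset, ?_, fun w hw => hX w (by simpa using hw)⟩
      rw [hF, Finset.mem_filter, Finset.mem_biUnion]
      exact ⟨⟨v, Finset.mem_univ _, hlen ▸ p.support_mem_walkSupports⟩, hcard,
        fun v hv w hw => hind v (by simpa using hv) w (by simpa using hw)⟩
    · exact Or.inl hreg
  calc _ ≤ _ := measure_mono hsub
    _ ≤ 0 + ∑ W ∈ F,
          bitsFamilyMeasure V {ρ | ∀ w ∈ W, G.Dangerous (G.fixNodes l (fun _ _ => none) ρ) w} := by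
        refine (measure_union_le _ _).trans (add_le_add ?_ (measure_biUnion_finset_le _ _))
        exact (ae_iff.1 (G.ae_regularRun hl _)).le
    _ ≤ ∑ W ∈ F, q ^ (i + 1) := by
        rw [zero_add]
        refine Finset.sum_le_sum fun W hW => ?_
        obtain ⟨hcard, hind⟩ := (Finset.mem_filter.1 hW).2
        refine (G.measure_dangerous_le hl hind).trans ?_
        rw [← hcard]
        exact Finset.prod_le_pow_card _ _ _ fun w _ => hq w
    _ ≤ _ := by
        rw [Finset.sum_const, nsmul_eq_mul]
        gcongr
        exact_mod_cast hFcard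

theorem IsRelaxedLLL.threshold_le {G : VEGraph V} {C : ℝ} {Δ : ℕ} (h : G.IsRelaxedLLL C Δ)
    (hC : 34 ≤ C) (hΔ : 2 ≤ Δ) (w : G.EventNode) : G.threshold w ≤ ((Δ : ENNReal) ^ 17)⁻¹ := by
  obtain ⟨p, hp, hw⟩ := h.2
  have hΔ1 : (1 : ℝ) ≤ Δ := by exact_mod_cast (by omega : 1 ≤ Δ)
  have hΔ0 : (0 : ℝ) < (Δ : ℝ) ^ 34 := by positivity
  have hpow : (Δ : ℝ) ^ 34 ≤ (Δ : ℝ) ^ C := by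
    rw [← Real.rpow_natCast]
    exact Real.rpow_le_rpow_of_exponent_le hΔ1 (by exact_mod_cast hC)
  have hprob : G.prob w ≤ ((Δ : ℝ) ^ 34)⁻¹ := by
    rw [← one_div, le_div_iff₀ hΔ0]
    have h0 : 0 ≤ G.prob w := measureReal_nonneg
    calc G.prob w * (Δ : ℝ) ^ 34 ≤ G.prob w * (Δ : ℝ) ^ C := by gcongr
      _ ≤ p * (Δ : ℝ) ^ C := by gcongr; exact hw w
      _ ≤ 1 := hp
  have hP : bitsFamilyMeasure V (G.occurs w) ≤ (((Δ : ENNReal) ^ 17)⁻¹) ^ 2 := by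
    rw [← ENNReal.ofReal_toReal (measure_ne_top (bitsFamilyMeasure V) (G.occurs w))]
    refine (ENNReal.ofReal_le_ofReal hprob).trans ?_
    rw [ENNReal.ofReal_inv_of_pos hΔ0, ENNReal.ofReal_pow (by positivity), ENNReal.ofReal_natCast,
      ENNReal.inv_pow, ENNReal.inv_pow, ← pow_mul]
  rw [threshold]
  refine (ENNReal.rpow_le_rpow hP (by norm_num)).trans ?_
  rw [← ENNReal.rpow_natCast, ← ENNReal.rpow_mul]
  norm_num

end VEGraph

/-! ### Arithmetic of the constants -/

theorem succ_log_mul_sq_le {n Δ : ℕ} (hn : 2 ≤ n) (hΔ : 2 ≤ Δ) :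
    ((Nat.log 2 n + 1 : ℕ) : ℝ) * ((Δ : ℝ) + 1) ^ 2 ≤ 8 * (Δ : ℝ) ^ 3 * Real.log n := by
  have h1 : 1 ≤ Nat.log 2 n := Nat.log_pos (by norm_num) hn
  have hlog : (Nat.log 2 n : ℝ) * Real.log 2 ≤ Real.log n := by
    rw [← Real.log_pow]
    refine Real.log_le_log (by positivity) ?_
    exact_mod_cast Nat.pow_log_le_self 2 (by omega)
  have h2 : (1 / 2 : ℝ) ≤ Real.log 2 := by linarith [Real.log_two_gt_d9]
  have h1' : (1 : ℝ) ≤ Nat.log 2 n := by exact_mod_cast h1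
  have h3 : (Nat.log 2 n : ℝ) * (1 / 2) ≤ Real.log n :=
    (mul_le_mul_of_nonneg_left h2 (by positivity)).trans hlog
  -- Since the binary logarithm is at least 1, adding 1 at most doubles it. This 4 and the 2 in `h5`
  -- make the 8.
  have h4 : ((Nat.log 2 n + 1 : ℕ) : ℝ) ≤ 4 * Real.log n := by
    push_cast
    linarith
  have hΔ' : (2 : ℝ) ≤ Δ := by exact_mod_cast hΔ
  have h5 : ((Δ : ℝ) + 1) ^ 2 ≤ 2 * (Δ : ℝ) ^ 3 := by
    nlinarith [mul_nonneg (sq_nonneg (Δ : ℝ)) (sub_nonneg.2 hΔ')]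
  calc _ ≤ 4 * Real.log n * (2 * (Δ : ℝ) ^ 3) :=
        mul_le_mul h4 h5 (by positivity) (by linarith)
    _ = _ := by ring

/-- Of the 17 factors `Δ` per dangerous event, 16 pay for the choice of the walk because `Δ + 1 ≤ Δ
^ 2`. The last one gives `Δ ^ i ≥ n ^ (c + 1)`, which pays for the starting node and the failure
probability. -/
theorem pow_mul_pow_le_of_two_le {n Δ c : ℕ} (hΔ : 2 ≤ Δ) :
    n * ((Δ + 1) ^ 4) ^ (2 * ((c + 1) * (Nat.log 2 n + 1))) * n ^ c ≤
      (Δ ^ 17) ^ ((c + 1) * (Nat.log 2 n + 1) + 1) := by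
  set i := (c + 1) * (Nat.log 2 n + 1) with hi
  have h1 : n ^ (c + 1) ≤ Δ ^ i := by
    calc n ^ (c + 1) ≤ (2 ^ (Nat.log 2 n + 1)) ^ (c + 1) :=
          Nat.pow_le_pow_left (Nat.lt_pow_succ_log_self (by norm_num) n).le _
      _ = 2 ^ i := by rw [← pow_mul, hi, mul_comm]
      _ ≤ Δ ^ i := Nat.pow_le_pow_left hΔ i
  have h2 : (Δ + 1) ^ 4 ≤ Δ ^ 8 := by
    calc (Δ + 1) ^ 4 ≤ (Δ ^ 2) ^ 4 := Nat.pow_le_pow_left (by nlinarith) 4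
      _ = Δ ^ 8 := by rw [← pow_mul]
  calc n * ((Δ + 1) ^ 4) ^ (2 * i) * n ^ c = n ^ (c + 1) * ((Δ + 1) ^ 4) ^ (2 * i) := by ring
    _ ≤ Δ ^ i * (Δ ^ 8) ^ (2 * i) := by gcongr
    _ = (Δ ^ 17) ^ i := by rw [← pow_mul, ← pow_mul, ← pow_add]; congr 1; ring
    _ ≤ (Δ ^ 17) ^ (i + 1) := Nat.pow_le_pow_right (by positivity) (Nat.le_succ i)

theorem mainTheorem9 :
    ∃ (C₀ : ℝ) (t : ℕ) (A : RandSeqLocalAlgorithm (fun _ => t) PartialBits),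
      ∀ c : ℕ, ∃ K : ℝ,
        ∀ C : ℝ, C₀ ≤ C → ∀ Δ : ℕ, 2 ≤ Δ →
        ∀ (V : Type) [Finite V] (G : VEGraph V), G.IsRelaxedLLL C Δ →
        ∀ order : List V, order.Nodup → (∀ v : V, v ∈ order) →
          (∀ (ρ : V → Bits) (v : G.EventNode),
            G.condProb (A.fixedBits G ρ order) v ≤ 1 / (3 * (Δ : ℝ))) ∧
          (bitsFamilyMeasure V).real
              {ρ | ¬ ∀ S : (G.residualGraph (A.fixedBits G ρ order)).ConnectedComponent,
                (S.supp.ncard : ℝ) ≤ K * (Δ : ℝ) ^ 3 * Real.log (Nat.card V)}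
            ≤ 1 / (Nat.card V : ℝ) ^ c := by
  -- The square root halves 34 to the exponent 17 of the threshold bound.
  refine ⟨34, 2, bitFixingAlgorithm, fun c => ⟨8 * (c + 1), ?_⟩⟩
  intro C hC Δ hΔ V _ G hG order hnd hmem
  have hΔ2 : (2 : ℝ) ≤ Δ := by exact_mod_cast hΔ
  have hΔ0 : (0 : ℝ) < Δ := by linarith
  have hθ := hG.threshold_le hC hΔ
  -- The type of a component depends on the fixed bits, so the run is replaced through a variable
  -- `f` and not by rewriting.
  suffices H : ∀ f : (V → Bits) → V → PartialBits, f = G.fixNodes order (fun _ _ => none) →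
      (∀ (ρ : V → Bits) (v : G.EventNode), G.condProb (f ρ) v ≤ 1 / (3 * (Δ : ℝ))) ∧
      (bitsFamilyMeasure V).real
          {ρ | ¬ ∀ S : (G.residualGraph (f ρ)).ConnectedComponent,
            (S.supp.ncard : ℝ) ≤ 8 * (c + 1) * (Δ : ℝ) ^ 3 * Real.log (Nat.card V)}
        ≤ 1 / (Nat.card V : ℝ) ^ c from
    H (fun ρ => bitFixingAlgorithm.fixedBits G ρ order)
      (funext fun ρ => bitFixingAlgorithm_fixedBits G ρ order)
  rintro _ rfl
  constructor
  · intro ρ v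
    have h := G.condMeasure_fixNodes_le hnd (s := fun _ _ => none) (fun _ _ => rfl) (w := v)
      (by
        rw [condMeasure_none, two_mul]
        exact (G.bitsFamilyMeasure_occurs_le_threshold v).trans (le_add_right le_rfl)) ρ
    have h' := h.trans (mul_le_mul_right (hθ v) 2)
    rw [G.condProb_eq_toReal]
    refine (ENNReal.toReal_mono (ENNReal.mul_ne_top (by simp) (by simp; omega)) h').trans ?_
    simp only [ENNReal.toReal_mul, ENNReal.toReal_inv, ENNReal.toReal_pow, ENNReal.toReal_natCast,
      ENNReal.toReal_ofNat]
    rw [← div_eq_mul_inv, div_le_div_iff₀ (by positivity) (by positivity)]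
    -- What remains is `6 * Δ ≤ Δ ^ 17`.
    have h16 : (2 : ℝ) ^ 16 ≤ (Δ : ℝ) ^ 16 := by gcongr
    nlinarith
  · rcases Nat.lt_or_ge (Nat.card V) 2 with hn | hn
    -- For `n = 0` the right side may be `1 / 0 = 0`, but there are no components; for `n = 1` it is
    -- 1.
    · interval_cases hcard : Nat.card V
      · have : IsEmpty V := by
          rcases Nat.card_eq_zero.1 hcard with h | h
          · exact h
          · exact absurd ‹Finite V› (not_finite_iff_infinite.2 h)
        have hempty : {ρ | ¬ ∀ S : (G.residualGraph
            (G.fixNodes order (fun _ _ => none) ρ)).ConnectedComponent,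
            (S.supp.ncard : ℝ) ≤ 8 * (c + 1) * (Δ : ℝ) ^ 3 * Real.log ((0 : ℕ) : ℝ)} = ∅ := by
          refine Set.eq_empty_of_forall_notMem fun ρ hρ => hρ fun S => ?_
          obtain ⟨v, -⟩ := S.nonempty_supp
          exact isEmptyElim v.1.1
        rw [hempty, measureReal_empty]
        positivity
      · simp
    · set n := Nat.card V with hn'
      set i := (c + 1) * (Nat.log 2 n + 1) with hi
      have hbound := G.measure_exists_large_component_le hG.1 hθ (by
        rw [ENNReal.inv_lt_one]
        exact_mod_cast Nat.one_lt_pow (by norm_num) (by omega)) hnd hmem i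
      have hsub : {ρ | ¬ ∀ S : (G.residualGraph
            (G.fixNodes order (fun _ _ => none) ρ)).ConnectedComponent,
            (S.supp.ncard : ℝ) ≤ 8 * (c + 1) * (Δ : ℝ) ^ 3 * Real.log n} ⊆
          {ρ | ∃ C : (G.residualGraph
            (G.fixNodes order (fun _ _ => none) ρ)).ConnectedComponent,
            i * (Δ + 1) ^ 2 < C.supp.ncard} := by
        intro ρ hρ
        obtain ⟨S, hS⟩ := not_forall.1 hρ
        refine ⟨S, not_le.1 fun hle => hS ?_⟩
        have h1 : (S.supp.ncard : ℝ) ≤ (i : ℝ) * ((Δ : ℝ) + 1) ^ 2 := by exact_mod_cast hle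
        refine h1.trans ?_
        have h2 := mul_le_mul_of_nonneg_left (succ_log_mul_sq_le hn hΔ)
          (by positivity : (0 : ℝ) ≤ c + 1)
        calc (i : ℝ) * ((Δ : ℝ) + 1) ^ 2
            = (c + 1) * (((Nat.log 2 n + 1 : ℕ) : ℝ) * ((Δ : ℝ) + 1) ^ 2) := by
              rw [hi]; push_cast; ring
          _ ≤ _ := h2
          _ = _ := by ring
      have hΔe : (Δ : ENNReal) ≠ 0 := by exact_mod_cast (by omega : Δ ≠ 0)
      have hle := ENNReal.toReal_mono (ENNReal.mul_ne_top (by finiteness)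
        (ENNReal.pow_ne_top (by simpa using by omega))) ((measure_mono hsub).trans hbound)
      refine hle.trans ?_
      have hn0 : (0 : ℝ) < n := by exact_mod_cast (by omega : 0 < n)
      have hnat : (n : ℝ) * (((Δ : ℝ) + 1) ^ 4) ^ (2 * i) * (n : ℝ) ^ c ≤
          ((Δ : ℝ) ^ 17) ^ (i + 1) := by
        exact_mod_cast pow_mul_pow_le_of_two_le (n := n) (c := c) hΔ
      have hcast : ((Δ : ENNReal) + 1).toReal = (Δ : ℝ) + 1 := by
        rw [ENNReal.toReal_add (by simp) (by simp)]; simp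
      simp only [ENNReal.toReal_mul, ENNReal.toReal_inv, ENNReal.toReal_pow,
        ENNReal.toReal_natCast, hcast]
      rw [inv_pow, ← div_eq_mul_inv, div_le_div_iff₀ (by positivity) (by positivity), one_mul]
      exact hnat
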